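/- Let $\|\cdot\|$ be the Euclidean norm on $\mathbb{R}^n$. For $h:\mathbb{R}^n\to(-\infty,\infty]$ write $\operatorname{dom}h=\{x: h(x)<\infty\}$; $h$ is called $m$-weakly convex if $h+\frac m2\|\cdot\|^2$ is convex on its (convex) effective domain, and $\partial h(x)$ denotes the Fréchet subdifferential, i.e. the set of all $g$ with $h(y)\ge h(x)+\langle g,y-x\rangle+o(\|y-x\|)$ as $y\to x$. For $\theta>0$, $\mathrm{env}_{\theta h}(x)=\inf_{y}\,h(y)+\frac1{2\theta}\|x-y\|^2$. Let $(\Omega,\mathcal F,\mathbb P)$ be a probability space, let $\xi^0,\xi^1,\dots$ be random elements of a measurable space $\Xi$, and let $\mathcal F_k=\sigma(\xi^0,\dots,\xi^{k-1})$. Let $f:\mathbb{R}^n\to\mathbb{R}$, $\varphi:\mathbb{R}^n\to(-\infty,\infty]$, $\psi=f+\varphi$, and let $f_x(y,\xi)\in\mathbb{R}$ ($x,y\in\mathbb{R}^n$, $\xi\in\Xi$) be a family of model functions. Let $\{x^k\}_{k\ge0}$ be adapted to $\{\mathcal F_k\}$ and generated by the stochastic model-based method $$x^{k+1}\in\operatorname{argmin}_{y\in\mathbb{R}^n}\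 f_{x^k}(y,\xi^k)+\varphi(y)+\frac{1}{2\alpha_k}\|y-x^k\|^2\qquad\text{a.s. for all }k .$$ Let $\eta,\rho,\tau,\mathsf C,\mathsf D,\mathsf L_\varphi,\mathsf L_f,\mathsf L\ge0$ and $\bar f,\bar\varphi\in\mathbb{R}$, and assume: (E.1) for all $k$, the random variables $f_{x^k}(x^k,\xi^k)$ and $f_{x^k}(y,\xi^k)$, $y\in\operatorname{dom}\varphi$, are integrable, $\mathbb{E}[f_{x^k}(x^k,\xi^k)\mid\mathcal F_k]=f(x^k)$ a.s., and $\mathbb{E}[f_{x^k}(y,\xi^k)-f(y)\mid\mathcal F_k]\le\frac\tau2\|x^k-y\|^2$ a.s. for every $y\in\operatorname{dom}\varphi$; (E.2) for all $k$, $y\mapsto f_{x^k}(y,\xi^k)$ is $\eta$-weakly convex a.s.; (E.3) there are square-integrable random vectors $g^k$ with $g^k\in\partial f_{x^k}(\cdot,\xi^k)(x^k)$ a.s. and $\mathbb{E}[\|g^k\|^2\mid\mathcal F_k]\le\mathsf C[f(x^k)-\bar f]+\mathsf D$ a.s. for all $k$; (E.4) $\varphi$ is $\rho$-weakly convex, proper,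 lower semicontinuous, $\mathsf L_\varphi$-Lipschitz continuous on $\operatorname{dom}\varphi$, and $\varphi\ge\bar\varphi$ on $\operatorname{dom}\varphi$; (E.5) $\alpha_k>0$ and $\alpha_k\eta<1$ for all $k$ (so that every subproblem has a minimizer), $\sum_k\alpha_k=\infty$ and $\sum_k\alpha_k^2<\infty$. Assume moreover that one of the following holds: (F.1) $f\ge\bar f$ on $\operatorname{dom}\varphi$ and $f$ is $\mathsf L_f$-Lipschitz continuous on $\operatorname{dom}\varphi$; or (F.2) $f\ge\bar f$ on $\mathbb{R}^n$, and $f$ is differentiable with $\mathsf L$-Lipschitz continuous gradient on $\mathbb{R}^n$. Finally, let $\psi$ be $(\eta+\rho+\tau)$-weakly convex (so that $\mathrm{env}_{\theta\psi}$ is differentiable for the $\theta$ below). Then, for all $\theta\in(0,(\eta+\rho+\tau)^{-1})$ (with $0^{-1}=\infty$), the function $\mathrm{env}_{\theta\psi}$ is differentiable on $\mathbb{R}^n$, each $\|\nabla\mathrm{env}_{\theta\psi}(x^k)\|$ is integrable, $\lim_{k\to\infty}\mathbb{E}[\|\nabla\mathrm{env}_{\theta\psi}(x^k)\|]=0$,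 and $\lim_{k\to\infty}\|\nabla\mathrm{env}_{\theta\psi}(x^k)\|=0$ almost surely. -/

import Mathlib

open MeasureTheory Filter Topology
open scoped NNReal

/-- The effective domain `{x | h x < ∞}` of an extended-real-valued function. -/
def effDom {E : Type*} (h : E → EReal) : Set E := {x | h x < ⊤}

/-- `h : E → (-∞, ∞]` is `m`-weakly convex: `h + (m / 2) ‖·‖²` is convex on the effective domain
of `h` (in particular, the effective domain is a convex set). -/
def WeaklyConvex {E : Type*} [NormedAddCommGroup E] [NormedSpace ℝ E] (m : ℝ) (h : E → EReal) :
    Prop :=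
  ConvexOn ℝ (effDom h) (fun x => (h x).toReal + m / 2 * ‖x‖ ^ 2)

/-- The Fréchet (regular) subdifferential of a real-valued function at `x`: all `g` with
`h y ≥ h x + ⟪g, y - x⟫ + o(‖y - x‖)` as `y → x`. -/
def frechetSubdiff {E : Type*} [NormedAddCommGroup E] [InnerProductSpace ℝ E] (h : E → ℝ) (x : E) :
    Set E :=
  {g | ∀ ε : ℝ, 0 < ε → ∀ᶠ y in 𝓝 x, h x + inner ℝ g (y - x) - ε * ‖y - x‖ ≤ h y}

/-- The Moreau envelope `x ↦ inf_y h y + ‖x - y‖² / (2 θ)`, as a real number. -/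
noncomputable def moreauEnv {E : Type*} [NormedAddCommGroup E] (θ : ℝ) (h : E → EReal) (x : E) :
    ℝ :=
  (⨅ y : E, h y + ((1 / (2 * θ) * ‖x - y‖ ^ 2 : ℝ) : EReal)).toReal

/-- The filtration `ℱ k = σ(ξ 0, …, ξ (k - 1))` generated by the past samples. -/
def sampleFiltration {Ω Ξ : Type*} [mΩ : MeasurableSpace Ω] [mΞ : MeasurableSpace Ξ]
    (ξ : ℕ → Ω → Ξ) (hξ : ∀ k, Measurable (ξ k)) : Filtration ℕ mΩ where
  seq k := ⨆ i : ℕ, ⨆ _ : i < k, MeasurableSpace.comap (ξ i) mΞ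
  mono' _ _ hkl := iSup_mono fun _ => iSup_mono' fun hi => ⟨lt_of_lt_of_le hi hkl, le_rfl⟩
  le' _ := iSup_le fun i => iSup_le fun _ => (hξ i).comap_le

/-- The composite objective `ψ = f + φ`. -/
noncomputable def compositeObj {E : Type*} (f : E → ℝ) (φ : E → EReal) (x : E) : EReal :=
  (f x : EReal) + φ x

/-- `f` is bounded from below by `fbar` and `Lf`-Lipschitz continuous on `dom φ`. -/
def LipschitzScenario {E : Type*} [NormedAddCommGroup E] (f : E → ℝ) (φ : E → EReal)
    (fbar : ℝ) (Lf : ℝ≥0) : Prop :=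
  (∀ x ∈ effDom φ, fbar ≤ f x) ∧ LipschitzOnWith Lf f (effDom φ)

/-- `f` is bounded from below by `fbar` and differentiable with `L`-Lipschitz gradient on the
whole space. -/
def SmoothScenario {E : Type*} [NormedAddCommGroup E] [InnerProductSpace ℝ E] [CompleteSpace E]
    (f : E → ℝ) (fbar : ℝ) (L : ℝ≥0) : Prop :=
  (∀ x, fbar ≤ f x) ∧ Differentiable ℝ f ∧ LipschitzWith L (gradient f)

/-!
The Moreau envelope of `ψ`, with parameter `θ`, serves as a Lyapunov function. Comparing the step
from `x k` with the proximal point of `ψ` at `x k` decreases the envelope, in conditional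
expectation, by a multiple of `α k * ‖∇ env (x k)‖ ^ 2`, up to an error of order `α k ^ 2`
proportional to `E[‖g k‖ ^ 2 | ℱ k]`. In both scenarios that second moment is at most a multiple of
`1 + env (x k)` shifted by a lower bound of `ψ`, so the error is relative to the normalized envelope
and, the squared step sizes being summable, Robbins-Siegmund type arguments give
`∑ α k * ‖∇ env (x k)‖ ^ 2 < ∞` both in expectation and almost surely. Since `∑ α k = ∞` this yields
convergence along a subsequence; because `‖∇ env‖` is Lipschitz and the steps have length
`O(α k * (1 + ‖g k‖))`, it cannot oscillate without consuming the summable quantity, so the whole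
sequence tends to zero.
-/

lemma le_of_forall_mem_Ioo_le_add_mul {a b c : ℝ}
    (h : ∀ t ∈ Set.Ioo (0 : ℝ) 1, a ≤ b + t * c) : a ≤ b := by
  have hlim : Tendsto (fun t : ℝ => b + t * c) (𝓝[>] 0) (𝓝 b) := by
    have hcont : Continuous fun t : ℝ => b + t * c := by fun_prop
    simpa using (hcont.tendsto 0).mono_left nhdsWithin_le_nhds
  exact ge_of_tendsto hlim (mem_of_superset (Ioo_mem_nhdsGT one_pos) h)

section StrongConvexity

variable {E : Type*} [NormedAddCommGroup E] {K : Set E} {h : E → ℝ} {m : ℝ}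

section NormedSpace

variable [NormedSpace ℝ E]

lemma add_mul_norm_sub_sq_le_of_isMinOn (hh : StrongConvexOn K m h) {p y : E} (hp : p ∈ K)
    (hmin : IsMinOn h K p) (hy : y ∈ K) : h p + m / 2 * ‖y - p‖ ^ 2 ≤ h y := by
  refine le_of_forall_mem_Ioo_le_add_mul (c := m / 2 * ‖y - p‖ ^ 2) fun t ht => ?_
  have ht' : 0 ≤ 1 - t := sub_nonneg.2 ht.2.le
  have hmem : (1 - t) • p + t • y ∈ K := hh.1 hp hy ht' ht.1.le (by ring)
  have hconv := (hmin hmem).trans (hh.2 hp hy ht' ht.1.le (by ring))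
  simp only [smul_eq_mul, norm_sub_rev p y] at hconv
  refine le_of_mul_le_mul_left ?_ ht.1
  linarith

lemma mul_norm_sub_sq_le_of_lt_add (hh : StrongConvexOn K m h) {I δ ε : ℝ}
    (hI : ∀ y ∈ K, I ≤ h y) {u v : E} (hu : u ∈ K) (hv : v ∈ K) (hhu : h u < I + δ)
    (hhv : h v < I + ε) : m * ‖u - v‖ ^ 2 ≤ 4 * (δ + ε) := by
  have half : (0 : ℝ) ≤ 1 / 2 := by norm_num
  have hlow := hI _ (hh.1 hu hv half half (by norm_num))
  have hconv := hh.2 hu hv half half (by norm_num)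
  simp only [smul_eq_mul] at hconv
  linarith

/- Strong convexity makes every minimizing sequence Cauchy, so no compactness is needed. -/
lemma exists_isMinOn_of_strongConvexOn (hh : StrongConvexOn K m h) (hm : 0 < m)
    (hK : IsComplete K) (hne : K.Nonempty) (hbdd : BddBelow (h '' K))
    (hlsc : LowerSemicontinuousOn h K) : ∃ p ∈ K, IsMinOn h K p := by
  have hI : ∀ y ∈ K, sInf (h '' K) ≤ h y := fun y hy => csInf_le hbdd ⟨y, hy, rfl⟩
  have happrox : ∀ n : ℕ, ∃ y ∈ K, h y < sInf (h '' K) + 1 / ((n : ℝ) + 1) := fun n => by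
    obtain ⟨_, ⟨y, hy, rfl⟩, hlt⟩ := exists_lt_of_csInf_lt (hne.image h)
      (lt_add_of_pos_right (sInf (h '' K)) (Nat.one_div_pos_of_nat (n := n)))
    exact ⟨y, hy, hlt⟩
  choose u huK hu using happrox
  have hcauchy : CauchySeq u := by
    refine cauchySeq_of_le_tendsto_0' (fun n : ℕ => √(8 / m * (1 / ((n : ℝ) + 1))))
      (fun i j hij => ?_) ?_
    · rw [dist_eq_norm]
      refine Real.le_sqrt_of_sq_le ?_
      have hdist := mul_norm_sub_sq_le_of_lt_add hh hI (huK i) (huK j) (hu i) (hu j)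
      have hmono := Nat.one_div_le_one_div (α := ℝ) hij
      rw [div_mul_eq_mul_div, le_div_iff₀ hm]
      linarith
    · simpa using (tendsto_one_div_add_atTop_nhds_zero_nat.const_mul (8 / m)).sqrt
  obtain ⟨p, hp, hup⟩ := cauchySeq_tendsto_of_isComplete hK huK hcauchy
  have hmin : h p ≤ sInf (h '' K) := by
    refine le_of_forall_lt_imp_le_of_dense fun c hc => ?_
    have hev := (tendsto_nhdsWithin_iff.2 ⟨hup, .of_forall huK⟩).eventually (hlsc p hp c hc)
    have hlim := tendsto_one_div_add_atTop_nhds_zero_nat.const_add (sInf (h '' K))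
    rw [add_zero] at hlim
    exact ge_of_tendsto hlim (hev.mono fun n hn => (hn.trans (hu n)).le)
  exact ⟨p, hp, fun y hy => hmin.trans (hI y hy)⟩

end NormedSpace

section InnerProductSpace

variable [InnerProductSpace ℝ E]

lemma strongConvexOn_mul_norm_sub_sq (hK : Convex ℝ K) (r : ℝ) (x : E) :
    StrongConvexOn K r fun y => r / 2 * ‖y - x‖ ^ 2 := by
  refine ⟨hK, fun u _ v _ a b _ _ hab => le_of_eq ?_⟩
  have hcomb : a • u + b • v - x = a • (u - x) + b • (v - x) := by
    rw [smul_sub, smul_sub, sub_add_sub_comm, ← add_smul, hab, one_smul]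
  simp only [smul_eq_mul]
  rw [hcomb, ← sub_sub_sub_cancel_right u v x, norm_add_sq_real, norm_sub_sq_real (u - x),
    real_inner_smul_left, real_inner_smul_right, norm_smul, norm_smul, mul_pow, mul_pow,
    Real.norm_eq_abs, Real.norm_eq_abs, sq_abs, sq_abs, eq_sub_of_add_eq hab]
  ring

lemma strongConvexOn_add_mul_norm_sub_sq (hh : StrongConvexOn K m h) (r : ℝ) (x : E) :
    StrongConvexOn K (m + r) fun y => h y + r / 2 * ‖y - x‖ ^ 2 := by
  have hsum := UniformConvexOn.add hh (strongConvexOn_mul_norm_sub_sq hh.1 r x)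
  refine UniformConvexOn.mono (fun s => ?_) hsum
  simp only [Pi.add_apply]
  linarith

lemma add_inner_add_mul_le_of_mem_frechetSubdiff (hh : StrongConvexOn K m h) {x y g : E}
    (hg : g ∈ frechetSubdiff h x) (hx : x ∈ K) (hy : y ∈ K) :
    h x + inner ℝ g (y - x) + m / 2 * ‖y - x‖ ^ 2 ≤ h y := by
  refine le_of_forall_mem_Ioo_le_add_mul (c := ‖y - x‖) fun ε hε => ?_
  have hseg : Tendsto (fun t : ℝ => x + t • (y - x)) (𝓝[>] 0) (𝓝 x) := by
    have hcont : Continuous fun t : ℝ => x + t • (y - x) := by fun_prop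
    simpa using (hcont.tendsto 0).mono_left nhdsWithin_le_nhds
  have hlim : Tendsto (fun t : ℝ => h y - (1 - t) * (m / 2 * ‖y - x‖ ^ 2)) (𝓝[>] 0)
      (𝓝 (h y - m / 2 * ‖y - x‖ ^ 2)) := by
    have hcont : Continuous fun t : ℝ => h y - (1 - t) * (m / 2 * ‖y - x‖ ^ 2) := by fun_prop
    simpa using (hcont.tendsto 0).mono_left nhdsWithin_le_nhds
  suffices hslope : h x + inner ℝ g (y - x) - ε * ‖y - x‖ ≤ h y - m / 2 * ‖y - x‖ ^ 2 by linarith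
  refine ge_of_tendsto hlim ?_
  filter_upwards [hseg.eventually (hg ε hε.1), Ioo_mem_nhdsGT one_pos] with t hsub ht
  have hconv := hh.2 hx hy (sub_nonneg.2 ht.2.le) ht.1.le (by ring)
  have hcomb : (1 - t) • x + t • y = x + t • (y - x) := by module
  rw [hcomb] at hconv
  simp only [smul_eq_mul, norm_sub_rev x y] at hconv
  simp only [add_sub_cancel_left, inner_smul_right, norm_smul, Real.norm_eq_abs,
    abs_of_pos ht.1] at hsub
  refine le_of_mul_le_mul_left ?_ ht.1
  linarith

end InnerProductSpace

end StrongConvexity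

section ProperFunction

variable {E : Type*} {h φ : E → EReal} {H : E → ℝ}

/-- A proper function `E → (-∞, ∞]`: it never takes the value `-∞`, and it is finite somewhere. -/
structure ProperFunction (h : E → EReal) : Prop where
  ne_bot : ∀ y, h y ≠ ⊥
  nonempty : (effDom h).Nonempty

lemma eq_top_of_notMem_effDom {y : E} (hy : y ∉ effDom h) : h y = ⊤ :=
  not_lt_top_iff.1 hy

lemma ProperFunction.coe_toReal (hh : ProperFunction h) {y : E} (hy : y ∈ effDom h) :
    ((h y).toReal : EReal) = h y :=
  EReal.coe_toReal (ne_of_lt hy) (hh.ne_bot y)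

lemma ProperFunction.isMinOn_add_coe_iff (hh : ProperFunction h) {q : E → ℝ} {p : E} :
    IsMinOn (fun y => h y + (q y : EReal)) Set.univ p ↔
      p ∈ effDom h ∧ IsMinOn (fun y => (h y).toReal + q y) (effDom h) p := by
  have hval : ∀ y ∈ effDom h, h y + (q y : EReal) = (((h y).toReal + q y : ℝ) : EReal) :=
    fun y hy => by rw [EReal.coe_add, hh.coe_toReal hy]
  refine ⟨fun hmin => ?_, fun ⟨hp, hmin⟩ y _ => ?_⟩
  · have hp : p ∈ effDom h := by
      by_contra hp
      obtain ⟨y, hy⟩ := hh.nonempty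
      have hle := hmin (Set.mem_univ y)
      simp only [Set.mem_ofPred_eq, eq_top_of_notMem_effDom hp, EReal.top_add_coe, hval y hy,
        top_le_iff] at hle
      exact EReal.coe_ne_top _ hle
    refine ⟨hp, fun y hy => ?_⟩
    have hle := hmin (Set.mem_univ y)
    simp only [Set.mem_ofPred_eq, hval p hp, hval y hy] at hle
    exact EReal.coe_le_coe_iff.1 hle
  · by_cases hy : y ∈ effDom h
    · simp only [Set.mem_ofPred_eq, hval p hp, hval y hy]
      exact EReal.coe_le_coe_iff.2 (hmin hy)
    · simp only [Set.mem_ofPred_eq, eq_top_of_notMem_effDom hy, EReal.top_add_coe, le_top]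

lemma effDom_coe : effDom (fun y => (H y : EReal)) = Set.univ :=
  Set.eq_univ_of_forall fun y => EReal.coe_lt_top (H y)

lemma effDom_compositeObj : effDom (compositeObj H φ) = effDom φ := by
  ext y
  rcases eq_or_ne (φ y) ⊤ with htop | htop
  · simp [effDom, compositeObj, htop]
  · simp [effDom, compositeObj, EReal.add_lt_top, htop, htop.lt_top]

lemma properFunction_compositeObj (hφ : ProperFunction φ) : ProperFunction (compositeObj H φ) where
  ne_bot y := by simp [compositeObj, EReal.add_eq_bot_iff, hφ.ne_bot y]
  nonempty := by rw [effDom_compositeObj]; exact hφ.nonempty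

lemma toReal_compositeObj (hφ : ProperFunction φ) {y : E} (hy : y ∈ effDom φ) :
    (compositeObj H φ y).toReal = H y + (φ y).toReal := by
  rw [compositeObj, EReal.toReal_add (EReal.coe_ne_top _) (EReal.coe_ne_bot _)
    (ne_of_lt hy) (hφ.ne_bot y), EReal.toReal_coe]

end ProperFunction

section WeaklyConvex

variable {E : Type*} [NormedAddCommGroup E] {h φ : E → EReal} {H : E → ℝ} {m η ρ : ℝ}

lemma weaklyConvex_iff_strongConvexOn [InnerProductSpace ℝ E] :
    WeaklyConvex m h ↔ StrongConvexOn (effDom h) (-m) fun y => (h y).toReal := by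
  simp only [strongConvexOn_iff_convex, WeaklyConvex, neg_div, neg_mul, sub_neg_eq_add]

lemma weaklyConvex_coe_iff_strongConvexOn [InnerProductSpace ℝ E] :
    WeaklyConvex m (fun y => (H y : EReal)) ↔ StrongConvexOn Set.univ (-m) H := by
  simp only [weaklyConvex_iff_strongConvexOn, effDom_coe, EReal.toReal_coe]

lemma weaklyConvex_compositeObj [NormedSpace ℝ E]
    (hH : WeaklyConvex η fun y => (H y : EReal)) (hφ : WeaklyConvex ρ φ)
    (hφ' : ProperFunction φ) : WeaklyConvex (η + ρ) (compositeObj H φ) := by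
  rw [WeaklyConvex, effDom_coe] at hH
  rw [WeaklyConvex, effDom_compositeObj]
  refine ((hH.subset (Set.subset_univ _) hφ.1).add hφ).congr fun y hy => ?_
  simp only [Pi.add_apply, toReal_compositeObj hφ' hy, EReal.toReal_coe]
  ring

end WeaklyConvex

section Prox

variable {E : Type*} [NormedAddCommGroup E] {h : E → EReal} {θ m b : ℝ} {x p : E} {P : E → E}

/-- `p` is a proximal point of `h` at `x` with parameter `θ`, that is, a minimizer of
`h + ‖· - x‖² / (2 θ)`. -/
def IsProx (θ : ℝ) (h : E → EReal) (x p : E) : Prop :=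
  IsMinOn (fun y => h y + ((1 / (2 * θ) * ‖y - x‖ ^ 2 : ℝ) : EReal)) Set.univ p

namespace IsProx

lemma mem_effDom (hp : IsProx θ h x p) (hh : ProperFunction h) : p ∈ effDom h :=
  (hh.isMinOn_add_coe_iff.1 hp).1

lemma isMinOn_effDom (hp : IsProx θ h x p) (hh : ProperFunction h) :
    IsMinOn (fun y => (h y).toReal + 1 / (2 * θ) * ‖y - x‖ ^ 2) (effDom h) p :=
  (hh.isMinOn_add_coe_iff.1 hp).2

lemma moreauEnv_eq (hp : IsProx θ h x p) (hh : ProperFunction h) :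
    moreauEnv θ h x = (h p).toReal + 1 / (2 * θ) * ‖p - x‖ ^ 2 := by
  have hinf : (⨅ y, h y + ((1 / (2 * θ) * ‖y - x‖ ^ 2 : ℝ) : EReal))
      = (((h p).toReal + 1 / (2 * θ) * ‖p - x‖ ^ 2 : ℝ) : EReal) := by
    rw [EReal.coe_add, hh.coe_toReal (hp.mem_effDom hh)]
    exact le_antisymm (iInf_le _ p) (le_iInf fun y => hp (Set.mem_univ y))
  simp only [moreauEnv, norm_sub_rev x, hinf, EReal.toReal_coe]

lemma moreauEnv_le (hp : IsProx θ h x p) (hh : ProperFunction h) {y : E} (hy : y ∈ effDom h) :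
    moreauEnv θ h x ≤ (h y).toReal + 1 / (2 * θ) * ‖y - x‖ ^ 2 :=
  hp.moreauEnv_eq hh ▸ hp.isMinOn_effDom hh hy

lemma add_norm_sub_sq_le_moreauEnv (hp : IsProx θ h x p) (hh : ProperFunction h)
    (hb : ∀ y ∈ effDom h, b ≤ (h y).toReal) :
    b + 1 / (2 * θ) * ‖p - x‖ ^ 2 ≤ moreauEnv θ h x :=
  (add_le_add_left (hb p (hp.mem_effDom hh)) _).trans_eq (hp.moreauEnv_eq hh).symm

end IsProx

variable [InnerProductSpace ℝ E]

lemma WeaklyConvex.strongConvexOn_add_mul_norm_sub_sq (hconv : WeaklyConvex m h) (θ : ℝ) (x : E) :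
    StrongConvexOn (effDom h) (1 / θ - m)
      fun y => (h y).toReal + 1 / (2 * θ) * ‖y - x‖ ^ 2 := by
  rw [show 1 / (2 * θ) = 1 / θ / 2 by rw [div_div, mul_comm], sub_eq_neg_add]
  exact _root_.strongConvexOn_add_mul_norm_sub_sq (weaklyConvex_iff_strongConvexOn.1 hconv) _ x

lemma WeaklyConvex.exists_isProx [CompleteSpace E] (hconv : WeaklyConvex m h)
    (hh : ProperFunction h) (hclosed : IsClosed (effDom h))
    (hlsc : LowerSemicontinuousOn (fun y => (h y).toReal) (effDom h))
    (hb : ∀ y ∈ effDom h, b ≤ (h y).toReal) (hθ : 0 < θ) (hm : θ * m < 1) (x : E) :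
    ∃ p, IsProx θ h x p := by
  have hmod : 0 < 1 / θ - m := by rwa [sub_pos, lt_div_iff₀' hθ]
  have hquad : Continuous fun y => 1 / (2 * θ) * ‖y - x‖ ^ 2 := by fun_prop
  have hbdd : ∀ y ∈ effDom h, b ≤ (h y).toReal + 1 / (2 * θ) * ‖y - x‖ ^ 2 :=
    fun y hy => (hb y hy).trans (le_add_of_nonneg_right (by positivity))
  obtain ⟨p, hp, hmin⟩ := exists_isMinOn_of_strongConvexOn
    (hconv.strongConvexOn_add_mul_norm_sub_sq θ x) hmod hclosed.isComplete hh.nonempty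
    ⟨b, Set.forall_mem_image.2 hbdd⟩
    (hlsc.add (hquad.lowerSemicontinuous.lowerSemicontinuousOn _))
  exact ⟨p, hh.isMinOn_add_coe_iff.2 ⟨hp, hmin⟩⟩

namespace IsProx

lemma moreauEnv_add_norm_sub_sq_le (hp : IsProx θ h x p) (hh : ProperFunction h)
    (hconv : WeaklyConvex m h) {y : E} (hy : y ∈ effDom h) :
    moreauEnv θ h x + (1 / θ - m) / 2 * ‖y - p‖ ^ 2
      ≤ (h y).toReal + 1 / (2 * θ) * ‖y - x‖ ^ 2 :=
  hp.moreauEnv_eq hh ▸ add_mul_norm_sub_sq_le_of_isMinOn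
    (hconv.strongConvexOn_add_mul_norm_sub_sq θ x) (hp.mem_effDom hh) (hp.isMinOn_effDom hh) hy

lemma lipschitzWith (hP : ∀ x, IsProx θ h x (P x)) (hh : ProperFunction h)
    (hconv : WeaklyConvex m h) (hθ : 0 < θ) (hm : θ * m < 1) :
    LipschitzWith (1 - θ * m)⁻¹.toNNReal P := by
  have hpos : 0 < 1 - θ * m := sub_pos.2 hm
  refine LipschitzWith.of_dist_le_mul fun x z => ?_
  rw [Real.coe_toNNReal _ (inv_pos.2 hpos).le, dist_eq_norm, dist_eq_norm, inv_mul_eq_div,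
    le_div_iff₀' hpos]
  have hx := (hP x).moreauEnv_add_norm_sub_sq_le hh hconv ((hP z).mem_effDom hh)
  have hz := (hP z).moreauEnv_add_norm_sub_sq_le hh hconv ((hP x).mem_effDom hh)
  rw [(hP x).moreauEnv_eq hh, norm_sub_rev (P z) (P x)] at hx
  rw [(hP z).moreauEnv_eq hh] at hz
  have hfour : ‖P z - x‖ ^ 2 - ‖P x - x‖ ^ 2 + ‖P x - z‖ ^ 2 - ‖P z - z‖ ^ 2
      = 2 * inner ℝ (P x - P z) (x - z) := by
    simp only [norm_sub_sq_real, inner_sub_left, inner_sub_right]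
    ring
  have hmono : (1 / θ - m) * ‖P x - P z‖ ^ 2 ≤ 1 / θ * inner ℝ (P x - P z) (x - z) := by
    have hscaled := congrArg (fun s => 1 / (2 * θ) * s) hfour
    ring_nf at hx hz hscaled ⊢
    linarith
  have hcs : ‖P x - P z‖ * ((1 - θ * m) * ‖P x - P z‖) ≤ ‖P x - P z‖ * ‖x - z‖ := by
    refine le_trans ?_ (real_inner_le_norm _ _)
    refine le_of_mul_le_mul_left (le_of_eq_of_le ?_ hmono) (one_div_pos.2 hθ)
    field_simp
  rcases (norm_nonneg (P x - P z)).eq_or_lt with hzero | hne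
  · rw [← hzero, mul_zero]; exact norm_nonneg _
  · exact le_of_mul_le_mul_left hcs hne

lemma moreauEnv_le_add_inner_add {z q : E} (hp : IsProx θ h x p) (hq : IsProx θ h z q)
    (hh : ProperFunction h) :
    moreauEnv θ h z ≤ moreauEnv θ h x + inner ℝ ((1 / θ) • (x - p)) (z - x)
      + 1 / (2 * θ) * ‖z - x‖ ^ 2 := by
  have hle := hq.moreauEnv_le hh (hp.mem_effDom hh)
  have hexpand : ‖p - z‖ ^ 2 = ‖p - x‖ ^ 2 + 2 * inner ℝ (x - p) (z - x) + ‖z - x‖ ^ 2 := by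
    rw [norm_sub_rev p z, norm_sub_rev p x, ← sub_add_sub_cancel' x p z, norm_add_sq_real]
  rw [hexpand] at hle
  rw [hp.moreauEnv_eq hh, real_inner_smul_left]
  ring_nf at hle ⊢
  exact hle

end IsProx

lemma hasGradientAt_of_le_add_inner_add_mul_sq [CompleteSpace E] {F : E → ℝ} {G : E → E} {c : ℝ}
    (hF : ∀ y z, F z ≤ F y + inner ℝ (G y) (z - y) + c * ‖z - y‖ ^ 2)
    (hG : ContinuousAt G x) : HasGradientAt F (G x) x := by
  rw [hasGradientAt_iff_hasFDerivAt, hasFDerivAt_iff_isLittleO]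
  have hbound : ∀ z, ‖F z - F x - inner ℝ (G x) (z - x)‖
      ≤ (‖G z - G x‖ + |c| * ‖z - x‖) * ‖z - x‖ := by
    intro z
    have hcs := neg_le_of_abs_le (abs_real_inner_le_norm (G z - G x) (z - x))
    have hup := hF x z
    have hlow := hF z x
    rw [← neg_sub z x, inner_neg_right, norm_neg] at hlow
    rw [inner_sub_left] at hcs
    have hc := mul_le_mul_of_nonneg_right (le_abs_self c) (sq_nonneg ‖z - x‖)
    have := mul_nonneg (norm_nonneg (G z - G x)) (norm_nonneg (z - x))
    rw [Real.norm_eq_abs, abs_le]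
    constructor <;> linarith
  have hmodulus : Tendsto (fun z => ‖G z - G x‖ + |c| * ‖z - x‖) (𝓝 x) (𝓝 0) := by
    have hcont : ContinuousAt (fun z => ‖G z - G x‖ + |c| * ‖z - x‖) x := by fun_prop
    simpa using hcont.tendsto
  refine Asymptotics.isLittleO_iff.2 fun ε hε => ?_
  filter_upwards [hmodulus.eventually_le_const hε] with z hz
  exact (hbound z).trans (mul_le_mul_of_nonneg_right hz (norm_nonneg _))

namespace IsProx

variable [CompleteSpace E]

lemma hasGradientAt_moreauEnv (hP : ∀ x, IsProx θ h x (P x)) (hh : ProperFunction h)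
    (hconv : WeaklyConvex m h) (hθ : 0 < θ) (hm : θ * m < 1) (x : E) :
    HasGradientAt (moreauEnv θ h) ((1 / θ) • (x - P x)) x :=
  hasGradientAt_of_le_add_inner_add_mul_sq (G := fun x => (1 / θ) • (x - P x))
    (fun y z => (hP y).moreauEnv_le_add_inner_add (hP z) hh)
    (by have := (lipschitzWith hP hh hconv hθ hm).continuous; fun_prop)

lemma gradient_moreauEnv (hP : ∀ x, IsProx θ h x (P x)) (hh : ProperFunction h)
    (hconv : WeaklyConvex m h) (hθ : 0 < θ) (hm : θ * m < 1) :
    gradient (moreauEnv θ h) = fun x => (1 / θ) • (x - P x) :=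
  funext fun x => (hasGradientAt_moreauEnv hP hh hconv hθ hm x).gradient

lemma lipschitzWith_gradient_moreauEnv (hP : ∀ x, IsProx θ h x (P x)) (hh : ProperFunction h)
    (hconv : WeaklyConvex m h) (hθ : 0 < θ) (hm : θ * m < 1) :
    LipschitzWith (‖1 / θ‖₊ * (1 + (1 - θ * m)⁻¹.toNNReal)) (gradient (moreauEnv θ h)) := by
  rw [gradient_moreauEnv hP hh hconv hθ hm]
  exact (lipschitzWith_smul (1 / θ)).comp (LipschitzWith.id.sub (lipschitzWith hP hh hconv hθ hm))

lemma norm_gradient_moreauEnv_sq_le (hP : ∀ x, IsProx θ h x (P x)) (hh : ProperFunction h)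
    (hconv : WeaklyConvex m h) (hb : ∀ y ∈ effDom h, b ≤ (h y).toReal) (hθ : 0 < θ)
    (hm : θ * m < 1) (x : E) :
    ‖gradient (moreauEnv θ h) x‖ ^ 2 ≤ 2 / θ * (moreauEnv θ h x - b) := by
  have henv := (hP x).add_norm_sub_sq_le_moreauEnv hh hb
  rw [gradient_moreauEnv hP hh hconv hθ hm, norm_smul, mul_pow, norm_sub_rev, Real.norm_eq_abs,
    sq_abs]
  calc (1 / θ) ^ 2 * ‖P x - x‖ ^ 2 = 2 / θ * (1 / (2 * θ) * ‖P x - x‖ ^ 2) := by field_simp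
    _ ≤ 2 / θ * (moreauEnv θ h x - b) := by gcongr; linarith

end IsProx

end Prox

section GapGrowth

variable {E : Type*} [NormedAddCommGroup E] {f : E → ℝ} {K : Set E} {b : ℝ} {L : ℝ≥0}

/-- `f` is continuous and bounded below by `b` on `K`, and the gap `f - b` at one point of `K`
controls the gap at any other up to a quadratic in the distance. Both alternatives for the
smooth part of the objective are used only through this property. -/
structure HasQuadraticGapGrowth (f : E → ℝ) (K : Set E) (b : ℝ) (A : ℝ≥0) : Prop where
  continuousOn : ContinuousOn f K
  le : ∀ y ∈ K, b ≤ f y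
  gap_le : ∀ x ∈ K, ∀ y ∈ K, f x - b ≤ A * (1 + (f y - b) + ‖x - y‖ ^ 2)

lemma LipschitzScenario.hasQuadraticGapGrowth {φ : E → EReal} (hf : LipschitzScenario f φ b L) :
    HasQuadraticGapGrowth f (effDom φ) b (L + 1) where
  continuousOn := hf.2.continuousOn
  le := hf.1
  gap_le x hx y hy := by
    have hlip := (le_abs_self _).trans (hf.2.norm_sub_le hx hy)
    have hdist : ‖x - y‖ ≤ 1 + ‖x - y‖ ^ 2 := by nlinarith [sq_nonneg (‖x - y‖ - 1)]
    have hscaled := mul_le_mul_of_nonneg_left hdist L.coe_nonneg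
    have hgap := mul_nonneg L.coe_nonneg (sub_nonneg.2 (hf.1 y hy))
    push_cast
    nlinarith [sq_nonneg ‖x - y‖]

variable [InnerProductSpace ℝ E] [CompleteSpace E]

lemma le_add_inner_gradient_add_of_lipschitzWith (hf : Differentiable ℝ f)
    (hL : LipschitzWith L (gradient f)) (x y : E) :
    f y ≤ f x + inner ℝ (gradient f x) (y - x) + L / 2 * ‖y - x‖ ^ 2 := by
  set v := y - x with hv
  let q : ℝ → ℝ := fun t =>
    f (x + t • v) - t * inner ℝ (gradient f x) v - L / 2 * ‖v‖ ^ 2 * t ^ 2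
  have hline (t : ℝ) : HasDerivAt (fun t : ℝ => x + t • v) v t := by
    simpa using ((hasDerivAt_id t).smul_const v).const_add x
  have hderiv (t : ℝ) : HasDerivAt q
      (inner ℝ (gradient f (x + t • v)) v - inner ℝ (gradient f x) v - L * ‖v‖ ^ 2 * t) t := by
    have hcomp :
        HasDerivAt (fun t : ℝ => f (x + t • v)) (inner ℝ (gradient f (x + t • v)) v) t := by
      have hchain := (hf (x + t • v)).hasGradientAt.hasFDerivAt.comp_hasDerivAt t (hline t)
      exact hchain
    have hquad : HasDerivAt (fun t : ℝ => (L : ℝ) / 2 * ‖v‖ ^ 2 * t ^ 2) (L * ‖v‖ ^ 2 * t) t :=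
      ((hasDerivAt_pow 2 t).const_mul ((L : ℝ) / 2 * ‖v‖ ^ 2)).congr_deriv (by push_cast; ring)
    exact (hcomp.sub (hasDerivAt_mul_const _)).sub hquad
  have hanti : AntitoneOn q (Set.Icc 0 1) := by
    refine antitoneOn_of_deriv_nonpos (convex_Icc 0 1)
      (fun t _ => (hderiv t).continuousAt.continuousWithinAt)
      (fun t _ => (hderiv t).differentiableAt.differentiableWithinAt) fun t ht => ?_
    rw [interior_Icc] at ht
    rw [(hderiv t).deriv, ← inner_sub_left]
    have hcs := real_inner_le_norm (gradient f (x + t • v) - gradient f x) v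
    have hlip := hL.norm_sub_le (x + t • v) x
    rw [add_sub_cancel_left, norm_smul, Real.norm_eq_abs, abs_of_pos ht.1] at hlip
    linarith [mul_le_mul_of_nonneg_right hlip (norm_nonneg v)]
  have hends := hanti (Set.left_mem_Icc.2 zero_le_one) (Set.right_mem_Icc.2 zero_le_one)
    zero_le_one
  simp only [q, hv, one_smul, zero_smul, add_zero, one_mul, zero_mul, add_sub_cancel] at hends
  linarith

lemma norm_gradient_sq_le_of_lipschitzWith (hf : Differentiable ℝ f)
    (hL : LipschitzWith L (gradient f)) (hb : ∀ x, b ≤ f x) (x : E) :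
    ‖gradient f x‖ ^ 2 ≤ 2 * L * (f x - b) := by
  set G := ‖gradient f x‖ ^ 2 with hG
  have hline (t : ℝ) : 0 ≤ L / 2 * G * (t * t) + -G * t + (f x - b) := by
    have hdescent := (hb _).trans (le_add_inner_gradient_add_of_lipschitzWith hf hL x
      (x - t • gradient f x))
    rw [sub_sub_cancel_left, inner_neg_right, real_inner_smul_right, real_inner_self_eq_norm_sq,
      norm_neg, norm_smul, mul_pow, Real.norm_eq_abs, sq_abs] at hdescent
    linarith
  have hdiscrim := discrim_le_zero hline
  rcases (sq_nonneg ‖gradient f x‖).eq_or_lt with hzero | hpos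
  · rw [hG, ← hzero]
    exact mul_nonneg (by positivity) (sub_nonneg.2 (hb x))
  · refine le_of_mul_le_mul_left ?_ hpos
    rw [discrim] at hdiscrim
    linarith

lemma SmoothScenario.hasQuadraticGapGrowth (hf : SmoothScenario f b L) :
    HasQuadraticGapGrowth f K b (L + 1) where
  continuousOn := hf.2.1.continuous.continuousOn
  le y _ := hf.1 y
  gap_le x _ y _ := by
    obtain ⟨hb, hdiff, hlip⟩ := hf
    have hgap : 0 ≤ f y - b := sub_nonneg.2 (hb y)
    have hdescent := le_add_inner_gradient_add_of_lipschitzWith hdiff hlip y x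
    have hcs := real_inner_le_norm (gradient f y) (x - y)
    have hgrad : ‖gradient f y‖ * ‖x - y‖ ≤ L * (f y - b) + ‖x - y‖ ^ 2 / 2 := by
      refine (sq_le_sq₀ (by positivity) (by positivity)).1 ?_
      rw [mul_pow]
      have hsq := norm_gradient_sq_le_of_lipschitzWith hdiff hlip hb y
      nlinarith [mul_le_mul_of_nonneg_right hsq (sq_nonneg ‖x - y‖),
        sq_nonneg (L * (f y - b) - ‖x - y‖ ^ 2 / 2)]
    push_cast
    linarith [mul_nonneg L.coe_nonneg (sq_nonneg ‖x - y‖), L.coe_nonneg, sq_nonneg ‖x - y‖]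

end GapGrowth

lemma isClosed_effDom_of_lipschitzOnWith {E : Type*} [PseudoMetricSpace E] {φ : E → EReal}
    {L : ℝ≥0} (hbot : ∀ y, φ y ≠ ⊥) (hlsc : LowerSemicontinuous φ)
    (hlip : LipschitzOnWith L (fun y => (φ y).toReal) (effDom φ)) : IsClosed (effDom φ) := by
  refine isClosed_of_closure_subset fun x hx => by_contra fun hxK => ?_
  obtain ⟨y₀, hy₀, hdist₀⟩ := Metric.mem_closure_iff.1 hx 1 one_pos
  have hlarge : ∀ᶠ y in 𝓝 x, (((φ y₀).toReal + L * 2 : ℝ) : EReal) < φ y :=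
    hlsc x _ (lt_of_lt_of_eq (EReal.coe_lt_top _) (eq_top_of_notMem_effDom hxK).symm)
  obtain ⟨y, hyK, hy, hdist⟩ := ((mem_closure_iff_frequently.1 hx).and_eventually
    (hlarge.and (Metric.ball_mem_nhds x one_pos))).exists
  rw [← EReal.coe_toReal (ne_of_lt hyK) (hbot y), EReal.coe_lt_coe_iff] at hy
  have hdist' : dist y y₀ ≤ 2 := by
    linarith [dist_triangle y x y₀, Metric.mem_ball.1 hdist]
  have hle := (le_abs_self _).trans (hlip.dist_le_mul y hyK y₀ hy₀)
  linarith [mul_le_mul_of_nonneg_left hdist' L.coe_nonneg]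

lemma mul_le_mul_sq_add_sq_div {a : ℝ} (ha : 0 < a) (u v : ℝ) :
    u * v ≤ a / 4 * v ^ 2 + u ^ 2 / a := by
  have hsq : 0 ≤ (a * v / 2 - u) ^ 2 / a := by positivity
  have hexpand : (a * v / 2 - u) ^ 2 / a = a / 4 * v ^ 2 - u * v + u ^ 2 / a := by
    field_simp
    ring
  linarith

/-- Assumption (E.4) on the nonsmooth term: `φ` is proper, `ρ`-weakly convex, lower
semicontinuous, and on its effective domain `L`-Lipschitz and bounded below by `b`. -/
structure IsRegularizer {E : Type*} [NormedAddCommGroup E] [NormedSpace ℝ E] (φ : E → EReal)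
    (ρ : ℝ) (L : ℝ≥0) (b : ℝ) : Prop where
  proper : ProperFunction φ
  weaklyConvex : WeaklyConvex ρ φ
  lowerSemicontinuous : LowerSemicontinuous φ
  lipschitzOnWith : LipschitzOnWith L (fun y => (φ y).toReal) (effDom φ)
  le : ∀ y ∈ effDom φ, (b : EReal) ≤ φ y

namespace IsRegularizer

variable {E : Type*} [NormedAddCommGroup E] {φ : E → EReal} {ρ b : ℝ} {L : ℝ≥0}

lemma isClosed_effDom [NormedSpace ℝ E] (hφ : IsRegularizer φ ρ L b) : IsClosed (effDom φ) :=
  isClosed_effDom_of_lipschitzOnWith hφ.proper.ne_bot hφ.lowerSemicontinuous hφ.lipschitzOnWith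

lemma le_toReal [NormedSpace ℝ E] (hφ : IsRegularizer φ ρ L b) {y : E} (hy : y ∈ effDom φ) :
    b ≤ (φ y).toReal := by
  rw [← EReal.coe_le_coe_iff, hφ.proper.coe_toReal hy]
  exact hφ.le y hy

variable [InnerProductSpace ℝ E] {H f : E → ℝ} {x p g y z : E} {α η τ θ : ℝ}

lemma exists_isProx_compositeObj [CompleteSpace E] {m c : ℝ} {A : ℝ≥0}
    (hφ : IsRegularizer φ ρ L b) (hf : HasQuadraticGapGrowth f (effDom φ) c A)
    (hψ : WeaklyConvex m (compositeObj f φ)) (hθ : 0 < θ) (hm : θ * m < 1) (x : E) :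
    ∃ p, IsProx θ (compositeObj f φ) x p := by
  have hcont : ContinuousOn (fun y => (compositeObj f φ y).toReal) (effDom φ) :=
    (hf.continuousOn.add hφ.lipschitzOnWith.continuousOn).congr
      fun y hy => toReal_compositeObj hφ.proper hy
  refine hψ.exists_isProx (b := c + b) (properFunction_compositeObj hφ.proper) ?_ ?_ ?_ hθ hm x <;>
    rw [effDom_compositeObj]
  · exact hφ.isClosed_effDom
  · exact hcont.lowerSemicontinuousOn
  · intro y hy
    rw [toReal_compositeObj hφ.proper hy]
    exact add_le_add (hf.le y hy) (hφ.le_toReal hy)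

section Step

lemma mem_effDom_of_isProx (hφ : IsRegularizer φ ρ L b) (hp : IsProx α (compositeObj H φ) x p) :
    p ∈ effDom φ := by
  simpa only [effDom_compositeObj] using hp.mem_effDom (properFunction_compositeObj hφ.proper)

lemma model_step_le (hφ : IsRegularizer φ ρ L b) (hp : IsProx α (compositeObj H φ) x p)
    (hy : y ∈ effDom φ) :
    H p + (φ p).toReal + 1 / (2 * α) * ‖p - x‖ ^ 2
      ≤ H y + (φ y).toReal + 1 / (2 * α) * ‖y - x‖ ^ 2 := by
  have hmin := hp.isMinOn_effDom (properFunction_compositeObj hφ.proper)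
  rw [effDom_compositeObj] at hmin
  have hle := hmin hy
  simp only [Set.mem_ofPred_eq] at hle
  rwa [toReal_compositeObj hφ.proper hy,
    toReal_compositeObj hφ.proper (hφ.mem_effDom_of_isProx hp)] at hle

lemma mul_norm_step_sq_le (hφ : IsRegularizer φ ρ L b)
    (hH : WeaklyConvex η fun y => (H y : EReal)) (hg : g ∈ frechetSubdiff H x)
    (hp : IsProx α (compositeObj H φ) x p) (hα : 0 < α) (hαη : α * η < 1) (hy : y ∈ effDom φ) :
    (1 / α - η) / 4 * ‖p - x‖ ^ 2 ≤ H y - H x + (φ y).toReal - b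
      + 1 / (2 * α) * ‖y - x‖ ^ 2 + ‖g‖ ^ 2 / (1 / α - η) := by
  have hmod : 0 < 1 / α - η := by rwa [sub_pos, lt_div_iff₀' hα]
  have hsub := add_inner_add_mul_le_of_mem_frechetSubdiff
    (weaklyConvex_coe_iff_strongConvexOn.1 hH) hg (Set.mem_univ x) (Set.mem_univ p)
  have hstep := hφ.model_step_le hp hy
  have hb := hφ.le_toReal (hφ.mem_effDom_of_isProx hp)
  have hcs := neg_le_of_abs_le (abs_real_inner_le_norm g (p - x))
  have hyoung := mul_le_mul_sq_add_sq_div hmod ‖g‖ ‖p - x‖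
  rw [← div_div, div_right_comm] at hstep ⊢
  linarith

lemma sub_mul_norm_le_model (hφ : IsRegularizer φ ρ L b)
    (hH : WeaklyConvex η fun y => (H y : EReal)) (hg : g ∈ frechetSubdiff H x)
    (hx : x ∈ effDom φ) (hy : y ∈ effDom φ) :
    H x + (φ x).toReal - (‖g‖ + L) * ‖y - x‖ - η / 2 * ‖y - x‖ ^ 2 ≤ H y + (φ y).toReal := by
  have hsub := add_inner_add_mul_le_of_mem_frechetSubdiff
    (weaklyConvex_coe_iff_strongConvexOn.1 hH) hg (Set.mem_univ x) (Set.mem_univ y)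
  have hcs := neg_le_of_abs_le (abs_real_inner_le_norm g (y - x))
  have hlip := neg_le_of_abs_le (hφ.lipschitzOnWith.norm_sub_le hy hx)
  linarith

lemma norm_step_le (hφ : IsRegularizer φ ρ L b)
    (hH : WeaklyConvex η fun y => (H y : EReal)) (hg : g ∈ frechetSubdiff H x)
    (hp : IsProx α (compositeObj H φ) x p) (hx : x ∈ effDom φ) (hα : 0 < α)
    (hαη : α * η ≤ 1 / 2) : ‖p - x‖ ≤ 4 * α * (‖g‖ + L) := by
  have hmodel := hφ.sub_mul_norm_le_model hH hg hx (hφ.mem_effDom_of_isProx hp)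
  have hstep := hφ.model_step_le hp hx
  rw [sub_self, norm_zero] at hstep
  have hquad : (1 - α * η) * ‖p - x‖ ^ 2 ≤ 2 * α * ((‖g‖ + L) * ‖p - x‖) := by
    refine le_of_mul_le_mul_left ?_ (by positivity : 0 < 1 / (2 * α))
    have hleft : 1 / (2 * α) * ((1 - α * η) * ‖p - x‖ ^ 2)
        = 1 / (2 * α) * ‖p - x‖ ^ 2 - η / 2 * ‖p - x‖ ^ 2 := by field_simp
    have hright : 1 / (2 * α) * (2 * α * ((‖g‖ + L) * ‖p - x‖)) = (‖g‖ + L) * ‖p - x‖ := by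
      field_simp
    linarith
  have hhalf := mul_le_mul_of_nonneg_right hαη (sq_nonneg ‖p - x‖)
  rcases (norm_nonneg (p - x)).eq_or_lt with hzero | hpos
  · rw [← hzero]; positivity
  · refine le_of_mul_le_mul_left ?_ hpos
    linarith

lemma mul_norm_sub_step_sq_le (hφ : IsRegularizer φ ρ L b)
    (hH : WeaklyConvex η fun y => (H y : EReal)) (hg : g ∈ frechetSubdiff H x)
    (hp : IsProx α (compositeObj H φ) x p) (hx : x ∈ effDom φ) (hα : 0 < α)
    (hαη : α * η ≤ 1 / 2) (hz : z ∈ effDom φ) :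
    (1 - α * (η + ρ)) * ‖z - p‖ ^ 2 ≤ ‖z - x‖ ^ 2
      + 2 * α * (H z + (φ z).toReal - H x - (φ x).toReal) + 2 * α ^ 2 * (‖g‖ + L) ^ 2 := by
  have hproper := properFunction_compositeObj (H := H) hφ.proper
  have hmem := hφ.mem_effDom_of_isProx hp
  have hgrowth := hp.moreauEnv_add_norm_sub_sq_le hproper
    (weaklyConvex_compositeObj hH hφ.weaklyConvex hφ.proper) (effDom_compositeObj ▸ hz)
  rw [hp.moreauEnv_eq hproper, toReal_compositeObj hφ.proper hmem,
    toReal_compositeObj hφ.proper hz] at hgrowth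
  have hmodel := hφ.sub_mul_norm_le_model hH hg hx hmem
  have hscaled : ‖p - x‖ ^ 2 + (1 - α * (η + ρ)) * ‖z - p‖ ^ 2
      ≤ ‖z - x‖ ^ 2 + 2 * α * (H z + (φ z).toReal - H x - (φ x).toReal)
        + 2 * (α * (‖g‖ + L)) * ‖p - x‖ + α * η * ‖p - x‖ ^ 2 := by
    have hmul := mul_le_mul_of_nonneg_left (add_le_add hgrowth hmodel)
      (by positivity : 0 ≤ 2 * α)
    field_simp at hmul
    linarith
  have hhalf := mul_le_mul_of_nonneg_right hαη (sq_nonneg ‖p - x‖)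
  linarith [sq_nonneg (2 * (α * (‖g‖ + L)) - ‖p - x‖)]

lemma mul_moreauEnv_step_sub_le {q : E} (hφ : IsRegularizer φ ρ L b)
    (hH : WeaklyConvex η fun y => (H y : EReal)) (hg : g ∈ frechetSubdiff H x)
    (hp : IsProx α (compositeObj H φ) x p) (hx : x ∈ effDom φ) (hα : 0 < α)
    (hαη : α * η ≤ 1 / 2) (hαl : α * (η + ρ) ≤ 1)
    (hψ : WeaklyConvex (η + ρ + τ) (compositeObj f φ)) (hθ : 0 < θ)
    (hz : IsProx θ (compositeObj f φ) x z) (hq : IsProx θ (compositeObj f φ) p q) :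
    (1 - α * (η + ρ)) * (moreauEnv θ (compositeObj f φ) p - moreauEnv θ (compositeObj f φ) x)
      ≤ α / θ * ((H z - f z - τ / 2 * ‖x - z‖ ^ 2) - (H x - f x)
        - (1 / θ - (η + ρ + τ)) * ‖x - z‖ ^ 2 + α * (‖g‖ + L) ^ 2) := by
  have hproper := properFunction_compositeObj (H := f) hφ.proper
  have hzφ := hφ.mem_effDom_of_isProx hz
  have hstep := hφ.mul_norm_sub_step_sq_le hH hg hp hx hα hαη hzφ
  have hgrowth := hz.moreauEnv_add_norm_sub_sq_le hproper hψ (effDom_compositeObj ▸ hx)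
  have henv : moreauEnv θ (compositeObj f φ) p - moreauEnv θ (compositeObj f φ) x
      ≤ 1 / (2 * θ) * (‖z - p‖ ^ 2 - ‖z - x‖ ^ 2) := by
    rw [hz.moreauEnv_eq hproper]
    linarith [hq.moreauEnv_le hproper (hz.mem_effDom hproper)]
  rw [hz.moreauEnv_eq hproper, toReal_compositeObj hφ.proper hzφ,
    toReal_compositeObj hφ.proper hx, sub_self, norm_zero, norm_sub_rev x z] at hgrowth
  rw [norm_sub_rev x z]
  calc (1 - α * (η + ρ))
        * (moreauEnv θ (compositeObj f φ) p - moreauEnv θ (compositeObj f φ) x)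
      ≤ (1 - α * (η + ρ)) * (1 / (2 * θ) * (‖z - p‖ ^ 2 - ‖z - x‖ ^ 2)) :=
        mul_le_mul_of_nonneg_left henv (sub_nonneg.2 hαl)
    _ = 1 / (2 * θ) * ((1 - α * (η + ρ)) * ‖z - p‖ ^ 2 - (1 - α * (η + ρ)) * ‖z - x‖ ^ 2) := by
      ring
    _ ≤ 1 / (2 * θ) * (2 * α * ((H z - f z - τ / 2 * ‖z - x‖ ^ 2) - (H x - f x)
        - (1 / θ - (η + ρ + τ)) * ‖z - x‖ ^ 2 + α * (‖g‖ + L) ^ 2)) := by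
      refine mul_le_mul_of_nonneg_left ?_ (by positivity)
      have hscaled := mul_le_mul_of_nonneg_left hgrowth hα.le
      rw [← div_div, div_right_comm] at hscaled
      linarith
    _ = _ := by field_simp

end Step

end IsRegularizer

section Sequences

lemma abs_pow_three_sub_pow_three_le {a b d M : ℝ} (ha : 0 ≤ a) (hb : 0 ≤ b) (haM : a ≤ M)
    (hbM : b ≤ M) (hd : |b - a| ≤ d) : |b ^ 3 - a ^ 3| ≤ 3 * (d * a ^ 2) + 3 * M * d ^ 2 := by
  have hsq : (b - a) ^ 2 ≤ d ^ 2 := sq_le_sq' (abs_le.1 hd).1 (abs_le.1 hd).2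
  calc |b ^ 3 - a ^ 3| = |3 * a ^ 2 * (b - a) + (b + 2 * a) * (b - a) ^ 2| := by ring_nf
    _ ≤ |3 * a ^ 2 * (b - a)| + |(b + 2 * a) * (b - a) ^ 2| := abs_add_le _ _
    _ = 3 * a ^ 2 * |b - a| + (b + 2 * a) * (b - a) ^ 2 := by
        rw [abs_mul, abs_of_nonneg (by positivity : 0 ≤ 3 * a ^ 2),
          abs_of_nonneg (by positivity : 0 ≤ (b + 2 * a) * (b - a) ^ 2)]
    _ ≤ 3 * a ^ 2 * d + 3 * M * d ^ 2 := by
        have hsum : b + 2 * a ≤ 3 * M := by linarith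
        have hM : 0 ≤ 3 * M := by linarith
        gcongr
    _ = 3 * (d * a ^ 2) + 3 * M * d ^ 2 := by ring

variable {α a : ℕ → ℝ}

lemma eq_zero_of_tendsto_of_summable_mul_sq {r : ℝ} (hα : ∀ k, 0 ≤ α k) (hαs : ¬ Summable α)
    (hs : Summable fun k => α k * a k ^ 2) (hr : Tendsto a atTop (𝓝 r)) : r = 0 := by
  by_contra hr0
  refine hαs ((hs.mul_left (r ^ 2 / 2)⁻¹).of_norm_bounded_eventually_nat ?_)
  filter_upwards [(hr.pow 2).eventually (lt_mem_nhds (half_lt_self (by positivity)))] with k hk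
  rw [Real.norm_of_nonneg (hα k), inv_mul_eq_div, le_div_iff₀ (by positivity)]
  exact mul_le_mul_of_nonneg_left hk.le (hα k)

/- Summability of `α k * a k ^ 2` alone does not prevent oscillation. The increments of the cubes
`a k ^ 3` carry the extra factor `a k ^ 2`, which makes them summable. -/
lemma tendsto_zero_of_summable_mul_sq {d : ℕ → ℝ} {M : ℝ} (hα : ∀ k, 0 ≤ α k)
    (hαs : ¬ Summable α) (ha : ∀ k, 0 ≤ a k) (haM : ∀ k, a k ≤ M)
    (hstep : ∀ k, |a (k + 1) - a k| ≤ d k) (hd : Summable fun k => d k ^ 2)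
    (hda : Summable fun k => d k * a k ^ 2) (hαa : Summable fun k => α k * a k ^ 2) :
    Tendsto a atTop (𝓝 0) := by
  have hcauchy : CauchySeq fun k => a k ^ 3 := by
    refine cauchySeq_of_dist_le_of_summable (fun k => 3 * (d k * a k ^ 2) + 3 * M * d k ^ 2)
      (fun k => ?_) ((hda.mul_left 3).add (hd.mul_left (3 * M)))
    rw [dist_comm, Real.dist_eq]
    exact abs_pow_three_sub_pow_three_le (ha k) (ha (k + 1)) (haM k) (haM (k + 1)) (hstep k)
  obtain ⟨l, hl⟩ := cauchySeq_tendsto_of_complete hcauchy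
  have hlim : Tendsto a atTop (𝓝 (l ^ ((3 : ℕ) : ℝ)⁻¹)) :=
    (hl.rpow_const (Or.inr (by positivity))).congr fun k =>
      Real.pow_rpow_inv_natCast (ha k) three_ne_zero
  rwa [eq_zero_of_tendsto_of_summable_mul_sq hα hαs hαa hlim] at hlim

variable {β : ℕ → ℝ}

lemma prod_one_add_le_exp_tsum (hβ : ∀ k, 0 ≤ β k) (hβs : Summable β) (n : ℕ) :
    ∏ k ∈ Finset.range n, (1 + β k) ≤ Real.exp (∑' k, β k) :=
  calc ∏ k ∈ Finset.range n, (1 + β k) ≤ ∏ k ∈ Finset.range n, Real.exp (β k) :=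
        Finset.prod_le_prod (fun k _ => add_nonneg zero_le_one (hβ k)) fun k _ => by
          linarith [Real.add_one_le_exp (β k)]
    _ = Real.exp (∑ k ∈ Finset.range n, β k) := (Real.exp_sum _ _).symm
    _ ≤ Real.exp (∑' k, β k) := Real.exp_le_exp.2 (hβs.sum_le_tsum _ fun k _ => hβ k)

lemma exists_forall_le_and_summable_of_le_one_add_mul_sub {b E : ℕ → ℝ} (hβ : ∀ k, 0 ≤ β k)
    (hβs : Summable β) (hb : ∀ k, 0 ≤ b k) (hE : ∀ k, 0 ≤ E k)
    (hrec : ∀ k, E (k + 1) ≤ (1 + β k) * E k - b k) : (∃ M, ∀ k, E k ≤ M) ∧ Summable b := by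
  have hprod : ∀ n, E n ≤ (∏ k ∈ Finset.range n, (1 + β k)) * E 0 := by
    intro n
    induction n with
    | zero => simp
    | succ n ih =>
      rw [Finset.prod_range_succ]
      nlinarith [hrec n, hb n, hβ n]
  set M := Real.exp (∑' k, β k) * E 0
  have hM : ∀ n, E n ≤ M := fun n => (hprod n).trans <|
    mul_le_mul_of_nonneg_right (prod_one_add_le_exp_tsum hβ hβs n) (hE 0)
  refine ⟨⟨M, hM⟩, summable_of_sum_range_le (c := E 0 + M * ∑' k, β k) hb fun n => ?_⟩
  calc ∑ k ∈ Finset.range n, b k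
      ≤ ∑ k ∈ Finset.range n, ((E k - E (k + 1)) + M * β k) :=
        Finset.sum_le_sum fun k _ => by
          nlinarith [hrec k, mul_le_mul_of_nonneg_right (hM k) (hβ k)]
    _ = (E 0 - E n) + M * ∑ k ∈ Finset.range n, β k := by
        rw [Finset.sum_add_distrib, Finset.sum_range_sub', ← Finset.mul_sum]
    _ ≤ E 0 + M * ∑' k, β k := by
        have hsum := hβs.sum_le_tsum (Finset.range n) fun k _ => hβ k
        nlinarith [hE n, mul_le_mul_of_nonneg_left hsum ((hE 0).trans (hM 0))]

end Sequences

section Probability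

variable {Ω : Type*} [mΩ : MeasurableSpace Ω] {μ : Measure Ω}

lemma ae_summable_of_summable_integral {X : ℕ → Ω → ℝ} (hX : ∀ k, 0 ≤ᵐ[μ] X k)
    (hint : ∀ k, Integrable (X k) μ) (hs : Summable fun k => ∫ ω, X k ω ∂μ) :
    ∀ᵐ ω ∂μ, Summable fun k => X k ω := by
  have hnorm : ∀ k, eLpNorm (X k) 1 μ = ENNReal.ofReal (∫ ω, X k ω ∂μ) := fun k => by
    rw [eLpNorm_one_eq_lintegral_enorm, ← ofReal_integral_norm_eq_lintegral_enorm (hint k)]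
    congr 1
    exact integral_congr_ae ((hX k).mono fun ω hω => Real.norm_of_nonneg hω)
  refine (summable_norm_of_tsum_eLpNorm_ne_top le_rfl (fun k => (hint k).aestronglyMeasurable)
    ?_).mono fun ω hω => hω.of_norm
  simpa only [hnorm] using hs.tsum_ofReal_ne_top

lemma integrable_norm_sub_sq {E : Type*} [NormedAddCommGroup E] {X Y : Ω → E}
    (hX : MemLp X 2 μ) (hY : MemLp Y 2 μ) :
    Integrable (fun ω => ‖X ω - Y ω‖ ^ 2) μ :=
  (hX.sub hY).integrable_norm_pow two_ne_zero

lemma memLp_comp_of_lipschitzWith [IsFiniteMeasure μ] {E : Type*} [NormedAddCommGroup E]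
    {P : E → E} {K : ℝ≥0} {p : ENNReal} (hP : LipschitzWith K P) {X : Ω → E} (hX : MemLp X p μ) :
    MemLp (P ∘ X) p μ := by
  have hP0 : LipschitzWith K fun z => P z - P 0 := LipschitzWith.of_dist_le_mul fun y z => by
    rw [dist_sub_right]
    exact hP.dist_le_mul y z
  exact ((hP0.comp_memLp (sub_self _) hX).add (memLp_const (P 0))).ae_eq
    (Eventually.of_forall fun ω => sub_add_cancel _ _)

lemma integral_mul_le_of_condExp_le [IsFiniteMeasure μ] {m : MeasurableSpace Ω} (hm : m ≤ mΩ)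
    {X Y Z : Ω → ℝ} {c : ℝ} (hZ : StronglyMeasurable[m] Z) (hZ0 : ∀ ω, 0 ≤ Z ω)
    (hZc : ∀ ω, Z ω ≤ c) (hX : Integrable X μ) (hY : Integrable Y μ) (hXY : μ[X | m] ≤ᵐ[μ] Y) :
    ∫ ω, Z ω * X ω ∂μ ≤ ∫ ω, Z ω * Y ω ∂μ := by
  have hbound : ∀ᵐ ω ∂μ, ‖Z ω‖ ≤ c :=
    Eventually.of_forall fun ω => (Real.norm_of_nonneg (hZ0 ω)).trans_le (hZc ω)
  have hZY : Integrable (fun ω => Z ω * Y ω) μ :=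
    hY.bdd_mul (hZ.mono hm).aestronglyMeasurable hbound
  calc ∫ ω, Z ω * X ω ∂μ = ∫ ω, (μ[fun ω => Z ω * X ω | m]) ω ∂μ := (integral_condExp hm).symm
    _ ≤ ∫ ω, Z ω * Y ω ∂μ := by
        refine integral_mono_ae integrable_condExp hZY ?_
        filter_upwards [condExp_stronglyMeasurable_mul_of_bound hm hZ hX c hbound, hXY]
          with ω hpull hω
        exact hpull.trans_le (mul_le_mul_of_nonneg_left hω (hZ0 ω))

lemma integral_le_of_condExp_le {m : MeasurableSpace Ω} (hm : m ≤ mΩ) [SigmaFinite (μ.trim hm)]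
    {X Y : Ω → ℝ} (hY : Integrable Y μ) (hXY : μ[X | m] ≤ᵐ[μ] Y) :
    ∫ ω, X ω ∂μ ≤ ∫ ω, Y ω ∂μ :=
  (integral_condExp hm).symm.trans_le (integral_mono_ae integrable_condExp hY hXY)

lemma condExp_le_add_of_ae_le_add {m : MeasurableSpace Ω} (hm : m ≤ mΩ) [SigmaFinite (μ.trim hm)]
    {X U V W : Ω → ℝ} (hX : Integrable X μ) (hU : Integrable U μ) (hUm : StronglyMeasurable[m] U)
    (hV : Integrable V μ) (hle : X ≤ᵐ[μ] U + V) (hVW : μ[V | m] ≤ᵐ[μ] W) :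
    μ[X | m] ≤ᵐ[μ] U + W := by
  have hadd := condExp_add hU hV m
  rw [condExp_of_stronglyMeasurable hm hUm hU] at hadd
  filter_upwards [condExp_mono hX (hU.add hV) hle, hadd, hVW] with ω hmono hω hWω
  exact (hmono.trans_eq hω).trans (add_le_add_right hWω _)

lemma condExp_const_mul_le {m : MeasurableSpace Ω} {X W : Ω → ℝ} {r : ℝ} (hr : 0 ≤ r)
    (hXW : μ[X | m] ≤ᵐ[μ] W) : μ[fun ω => r * X ω | m] ≤ᵐ[μ] fun ω => r * W ω := by
  filter_upwards [condExp_smul r X m, hXW] with ω hsmul hω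
  exact hsmul.trans_le (mul_le_mul_of_nonneg_left hω hr)

lemma sq_integral_le_integral_sq [IsProbabilityMeasure μ] {X : Ω → ℝ} (hX : MemLp X 2 μ) :
    (∫ ω, X ω ∂μ) ^ 2 ≤ ∫ ω, X ω ^ 2 ∂μ := by
  have hvar := ProbabilityTheory.variance_nonneg X μ
  rw [ProbabilityTheory.variance_eq_sub hX] at hvar
  exact sub_nonneg.1 hvar

variable {ℱ : Filtration ℕ mΩ}

lemma ae_exists_tendsto_of_supermartingale_of_nonneg [IsFiniteMeasure μ] {M : ℕ → Ω → ℝ}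
    (hM : Supermartingale M ℱ μ) (hM0 : ∀ k ω, 0 ≤ M k ω) :
    ∀ᵐ ω ∂μ, ∃ l, Tendsto (fun k => M k ω) atTop (𝓝 l) := by
  have hbdd : ∀ k, eLpNorm ((-M) k) 1 μ ≤ ((∫ ω, M 0 ω ∂μ).toNNReal : ℝ≥0) := by
    intro k
    rw [Pi.neg_apply, eLpNorm_neg, eLpNorm_one_eq_lintegral_enorm,
      ← ofReal_integral_norm_eq_lintegral_enorm (hM.integrable k)]
    refine ENNReal.ofReal_le_ofReal ?_
    simp only [Real.norm_of_nonneg (hM0 k _)]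
    simpa only [setIntegral_univ] using hM.setIntegral_le (Nat.zero_le k) MeasurableSet.univ
  filter_upwards [hM.neg.exists_ae_tendsto_of_bdd hbdd] with ω ⟨l, hl⟩
  exact ⟨-l, by simpa only [Pi.neg_apply, neg_neg] using hl.neg⟩

lemma supermartingale_inv_prod_mul [IsFiniteMeasure μ] {e : ℕ → Ω → ℝ} {β : ℕ → ℝ}
    (hβ : ∀ k, 0 ≤ β k) (hem : ∀ k, StronglyMeasurable[ℱ k] (e k))
    (hei : ∀ k, Integrable (e k) μ)
    (hdesc : ∀ k, μ[e (k + 1) | ℱ k] ≤ᵐ[μ] fun ω => (1 + β k) * e k ω) :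
    Supermartingale (fun k ω => (∏ i ∈ Finset.range k, (1 + β i))⁻¹ * e k ω) ℱ μ := by
  have hpos : ∀ k, 0 < 1 + β k := fun k => by linarith [hβ k]
  refine supermartingale_nat (fun k => (hem k).const_mul _) (fun k => (hei k).const_mul _)
    fun k => ?_
  have hprod : 0 < ∏ i ∈ Finset.range (k + 1), (1 + β i) := Finset.prod_pos fun i _ => hpos i
  filter_upwards [condExp_smul (∏ i ∈ Finset.range (k + 1), (1 + β i))⁻¹ (e (k + 1)) (ℱ k),
    hdesc k] with ω hsmul hω
  refine hsmul.trans_le ((mul_le_mul_of_nonneg_left hω (inv_pos.2 hprod).le).trans_eq ?_)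
  rw [Finset.prod_range_succ, mul_inv, mul_assoc, inv_mul_cancel_left₀ (hpos k).ne']

lemma ae_exists_forall_le_of_condExp_le_one_add_mul [IsFiniteMeasure μ] {e : ℕ → Ω → ℝ}
    {β : ℕ → ℝ} (hβ : ∀ k, 0 ≤ β k) (hβs : Summable β) (he : ∀ k ω, 0 ≤ e k ω)
    (hem : ∀ k, StronglyMeasurable[ℱ k] (e k)) (hei : ∀ k, Integrable (e k) μ)
    (hdesc : ∀ k, μ[e (k + 1) | ℱ k] ≤ᵐ[μ] fun ω => (1 + β k) * e k ω) :
    ∀ᵐ ω ∂μ, ∃ M, ∀ k, e k ω ≤ M := by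
  have hprod : ∀ k, 0 < ∏ i ∈ Finset.range k, (1 + β i) := fun k =>
    Finset.prod_pos fun i _ => by linarith [hβ i]
  have hnonneg : ∀ k ω, 0 ≤ (∏ i ∈ Finset.range k, (1 + β i))⁻¹ * e k ω := fun k ω =>
    mul_nonneg (inv_pos.2 (hprod k)).le (he k ω)
  filter_upwards [ae_exists_tendsto_of_supermartingale_of_nonneg
    (supermartingale_inv_prod_mul hβ hem hei hdesc) hnonneg] with ω ⟨l, hl⟩
  obtain ⟨R, hR⟩ := hl.bddAbove_range
  refine ⟨Real.exp (∑' k, β k) * R, fun k => ?_⟩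
  calc e k ω = (∏ i ∈ Finset.range k, (1 + β i))
        * ((∏ i ∈ Finset.range k, (1 + β i))⁻¹ * e k ω) := by
        rw [mul_inv_cancel_left₀ (hprod k).ne']
    _ ≤ Real.exp (∑' k, β k) * R :=
        mul_le_mul (prod_one_add_le_exp_tsum hβ hβs k) (hR ⟨k, rfl⟩) (hnonneg k ω)
          (Real.exp_pos _).le

end Probability

/-- The abstract descent scheme behind the convergence proof: a merit process `e ≥ 1`, a
stationarity process `a` with `a ^ 2 ≤ c * e`, and a noise process `s` controlling the increments
of `a`, such that with step sizes `α` the merit decreases by `κ * α k * a k ^ 2` in conditional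
expectation, up to a relative error of order `α k ^ 2`. -/
structure StochasticDescent {Ω : Type*} [mΩ : MeasurableSpace Ω] (μ : Measure Ω)
    (ℱ : Filtration ℕ mΩ) (e a s : ℕ → Ω → ℝ) (α : ℕ → ℝ) (c κ : ℝ) : Prop where
  const_nonneg : 0 ≤ c
  rate_pos : 0 < κ
  step_pos : ∀ k, 0 < α k
  not_summable_step : ¬ Summable α
  summable_step_sq : Summable fun k => α k ^ 2
  one_le_merit : ∀ k ω, 1 ≤ e k ω
  stronglyMeasurable_merit : ∀ k, StronglyMeasurable[ℱ k] (e k)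
  integrable_merit : ∀ k, Integrable (e k) μ
  stationarity_nonneg : ∀ k ω, 0 ≤ a k ω
  stronglyMeasurable_stationarity : ∀ k, StronglyMeasurable[ℱ k] (a k)
  stationarity_sq_le : ∀ k ω, a k ω ^ 2 ≤ c * e k ω
  noise_nonneg : ∀ k ω, 0 ≤ s k ω
  memLp_noise : ∀ k, MemLp (s k) 2 μ
  condExp_noise_sq_le : ∀ k, μ[fun ω => s k ω ^ 2 | ℱ k] ≤ᵐ[μ] fun ω => c * e k ω
  abs_stationarity_sub_le : ∀ k, ∀ᵐ ω ∂μ, |a (k + 1) ω - a k ω| ≤ c * α k * (s k ω + 1)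
  condExp_merit_le : ∀ k, μ[e (k + 1) | ℱ k]
    ≤ᵐ[μ] fun ω => (1 + c * α k ^ 2) * e k ω - κ * α k * a k ω ^ 2

namespace StochasticDescent

variable {Ω : Type*} [mΩ : MeasurableSpace Ω] {μ : Measure Ω} {ℱ : Filtration ℕ mΩ}
  {e a s : ℕ → Ω → ℝ} {α : ℕ → ℝ} {c κ M : ℝ}

lemma merit_pos (h : StochasticDescent μ ℱ e a s α c κ) (k : ℕ) (ω : Ω) : 0 < e k ω :=
  one_pos.trans_le (h.one_le_merit k ω)

lemma const_mul_step_nonneg (h : StochasticDescent μ ℱ e a s α c κ) (k : ℕ) : 0 ≤ c * α k :=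
  mul_nonneg h.const_nonneg (h.step_pos k).le

lemma memLp_stationarity (h : StochasticDescent μ ℱ e a s α c κ) (k : ℕ) :
    MemLp (a k) 2 μ := by
  have ha : AEStronglyMeasurable (a k) μ :=
    ((h.stronglyMeasurable_stationarity k).mono (ℱ.le k)).aestronglyMeasurable
  refine (memLp_two_iff_integrable_sq ha).2 (((h.integrable_merit k).const_mul c).mono'
    (ha.pow 2) (Eventually.of_forall fun ω => ?_))
  exact (Real.norm_of_nonneg (sq_nonneg _)).trans_le (h.stationarity_sq_le k ω)

lemma stationarity_le_one_add (h : StochasticDescent μ ℱ e a s α c κ) {k : ℕ} {ω : Ω}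
    (hM : e k ω ≤ M) : a k ω ≤ 1 + c * M := by
  nlinarith [h.stationarity_sq_le k ω, mul_le_mul_of_nonneg_left hM h.const_nonneg,
    sq_nonneg (a k ω - 1)]

lemma noise_mul_stationarity_sq_le (h : StochasticDescent μ ℱ e a s α c κ) {k : ℕ} {ω : Ω}
    (hM : e k ω ≤ M) : (s k ω + 1) * a k ω ^ 2
      ≤ M * (a k ω ^ 2 / e k ω * s k ω ^ 2) + 2 * a k ω ^ 2 := by
  have hmerit : a k ω ^ 2 ≤ a k ω ^ 2 / e k ω * M := by
    rw [div_mul_eq_mul_div, le_div_iff₀ (h.merit_pos k ω)]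
    exact mul_le_mul_of_nonneg_left hM (sq_nonneg _)
  calc (s k ω + 1) * a k ω ^ 2 ≤ (s k ω ^ 2 + 2) * a k ω ^ 2 := by
        gcongr ?_ * _
        linarith [two_mul_le_add_sq (s k ω) 1, sq_nonneg (s k ω)]
    _ = s k ω ^ 2 * a k ω ^ 2 + 2 * a k ω ^ 2 := by ring
    _ ≤ s k ω ^ 2 * (a k ω ^ 2 / e k ω * M) + 2 * a k ω ^ 2 := by gcongr
    _ = M * (a k ω ^ 2 / e k ω * s k ω ^ 2) + 2 * a k ω ^ 2 := by ring

variable [IsProbabilityMeasure μ]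

lemma exists_integral_merit_le_and_summable (h : StochasticDescent μ ℱ e a s α c κ) :
    (∃ M, ∀ k, ∫ ω, e k ω ∂μ ≤ M) ∧ Summable fun k => α k * ∫ ω, a k ω ^ 2 ∂μ := by
  have hmerit : ∀ k, Integrable (fun ω => (1 + c * α k ^ 2) * e k ω) μ := fun k =>
    (h.integrable_merit k).const_mul _
  have hstat : ∀ k, Integrable (fun ω => κ * α k * a k ω ^ 2) μ := fun k =>
    (h.memLp_stationarity k).integrable_sq.const_mul _
  have hstat0 : ∀ k, 0 ≤ ∫ ω, a k ω ^ 2 ∂μ := fun k => integral_nonneg fun ω => sq_nonneg _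
  have hrec : ∀ k, ∫ ω, e (k + 1) ω ∂μ
      ≤ (1 + c * α k ^ 2) * ∫ ω, e k ω ∂μ - κ * (α k * ∫ ω, a k ω ^ 2 ∂μ) := fun k => by
    rw [← mul_assoc, ← integral_const_mul, ← integral_const_mul,
      ← integral_sub (hmerit k) (hstat k)]
    exact integral_le_of_condExp_le (ℱ.le k) ((hmerit k).sub (hstat k)) (h.condExp_merit_le k)
  obtain ⟨hbdd, hsum⟩ := exists_forall_le_and_summable_of_le_one_add_mul_sub
    (fun k => mul_nonneg h.const_nonneg (sq_nonneg (α k))) (h.summable_step_sq.mul_left c)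
    (fun k => mul_nonneg h.rate_pos.le (mul_nonneg (h.step_pos k).le (hstat0 k)))
    (fun k => integral_nonneg fun ω => (h.merit_pos k ω).le) hrec
  exact ⟨hbdd, (summable_mul_left_iff h.rate_pos.ne').1 hsum⟩

lemma integral_noise_sq_le (h : StochasticDescent μ ℱ e a s α c κ) {k : ℕ}
    (hM : ∫ ω, e k ω ∂μ ≤ M) : ∫ ω, s k ω ^ 2 ∂μ ≤ c * M :=
  calc ∫ ω, s k ω ^ 2 ∂μ ≤ ∫ ω, c * e k ω ∂μ :=
        integral_le_of_condExp_le (ℱ.le k) ((h.integrable_merit k).const_mul c)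
          (h.condExp_noise_sq_le k)
    _ = c * ∫ ω, e k ω ∂μ := integral_const_mul _ _
    _ ≤ c * M := mul_le_mul_of_nonneg_left hM h.const_nonneg

lemma abs_integral_stationarity_sub_le (h : StochasticDescent μ ℱ e a s α c κ) {k : ℕ}
    (hM : ∫ ω, e k ω ∂μ ≤ M) :
    |∫ ω, a (k + 1) ω ∂μ - ∫ ω, a k ω ∂μ| ≤ c * (c * M + 2) * α k := by
  have hs := (h.memLp_noise k).integrable one_le_two
  have hsq := (h.memLp_noise k).integrable_sq
  have ha := fun j => (h.memLp_stationarity j).integrable one_le_two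
  have hnoise : ∫ ω, (s k ω + 1) ∂μ ≤ c * M + 2 :=
    calc ∫ ω, (s k ω + 1) ∂μ ≤ ∫ ω, (s k ω ^ 2 + 2) ∂μ :=
          integral_mono (hs.add (integrable_const _)) (hsq.add (integrable_const _)) fun ω => by
            linarith [two_mul_le_add_sq (s k ω) 1, sq_nonneg (s k ω)]
      _ = ∫ ω, s k ω ^ 2 ∂μ + 2 := by
          rw [integral_add hsq (integrable_const _), integral_const, probReal_univ, one_smul]
      _ ≤ c * M + 2 := by linarith [h.integral_noise_sq_le hM]
  calc |∫ ω, a (k + 1) ω ∂μ - ∫ ω, a k ω ∂μ| = |∫ ω, (a (k + 1) ω - a k ω) ∂μ| := by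
        rw [integral_sub (ha _) (ha _)]
    _ ≤ ∫ ω, |a (k + 1) ω - a k ω| ∂μ := abs_integral_le_integral_abs
    _ ≤ ∫ ω, c * α k * (s k ω + 1) ∂μ :=
        integral_mono_ae ((ha _).sub (ha _)).abs ((hs.add (integrable_const _)).const_mul _)
          (h.abs_stationarity_sub_le k)
    _ = c * α k * ∫ ω, (s k ω + 1) ∂μ := integral_const_mul _ _
    _ ≤ c * α k * (c * M + 2) := mul_le_mul_of_nonneg_left hnoise (h.const_mul_step_nonneg k)
    _ = c * (c * M + 2) * α k := by ring

lemma integral_stationarity_le (h : StochasticDescent μ ℱ e a s α c κ) {k : ℕ}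
    (hM : ∫ ω, e k ω ∂μ ≤ M) : ∫ ω, a k ω ∂μ ≤ 1 + c * M := by
  have he : Integrable (fun ω => c * e k ω) μ := (h.integrable_merit k).const_mul c
  calc ∫ ω, a k ω ∂μ ≤ ∫ ω, (1 + c * e k ω) ∂μ :=
        integral_mono ((h.memLp_stationarity k).integrable one_le_two)
          ((integrable_const (1 : ℝ)).add he) fun ω => h.stationarity_le_one_add le_rfl
    _ = 1 + c * ∫ ω, e k ω ∂μ := by
        rw [integral_add (integrable_const (1 : ℝ)) he, integral_const_mul, integral_const,
          probReal_univ, one_smul]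
    _ ≤ 1 + c * M := by linarith [mul_le_mul_of_nonneg_left hM h.const_nonneg]

theorem tendsto_integral_stationarity (h : StochasticDescent μ ℱ e a s α c κ) :
    Tendsto (fun k => ∫ ω, a k ω ∂μ) atTop (𝓝 0) := by
  obtain ⟨⟨M, hM⟩, hsum⟩ := h.exists_integral_merit_le_and_summable
  have hsq : Summable fun k => α k * (∫ ω, a k ω ∂μ) ^ 2 :=
    hsum.of_nonneg_of_le (fun k => mul_nonneg (h.step_pos k).le (sq_nonneg _)) fun k =>
      mul_le_mul_of_nonneg_left (sq_integral_le_integral_sq (h.memLp_stationarity k))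
        (h.step_pos k).le
  refine tendsto_zero_of_summable_mul_sq (d := fun k => c * (c * M + 2) * α k)
    (fun k => (h.step_pos k).le) h.not_summable_step
    (fun k => integral_nonneg (h.stationarity_nonneg k))
    (fun k => h.integral_stationarity_le (hM k))
    (fun k => h.abs_integral_stationarity_sub_le (hM k)) ?_ ?_ hsq
  · exact (h.summable_step_sq.mul_left _).congr fun k => (mul_pow _ _ _).symm
  · exact (hsq.mul_left _).congr fun k => (mul_assoc _ _ _).symm

lemma ae_exists_forall_merit_le (h : StochasticDescent μ ℱ e a s α c κ) :
    ∀ᵐ ω ∂μ, ∃ M, ∀ k, e k ω ≤ M := by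
  refine ae_exists_forall_le_of_condExp_le_one_add_mul (β := fun k => c * α k ^ 2)
    (fun k => mul_nonneg h.const_nonneg (sq_nonneg _)) (h.summable_step_sq.mul_left c)
    (fun k ω => (h.merit_pos k ω).le) h.stronglyMeasurable_merit h.integrable_merit fun k => ?_
  filter_upwards [h.condExp_merit_le k] with ω hω
  exact hω.trans (sub_le_self _ <|
    mul_nonneg (mul_pos h.rate_pos (h.step_pos k)).le (sq_nonneg _))

lemma ae_summable_mul_stationarity_sq (h : StochasticDescent μ ℱ e a s α c κ) :
    ∀ᵐ ω ∂μ, Summable fun k => α k * a k ω ^ 2 := by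
  refine ae_summable_of_summable_integral (fun k => Eventually.of_forall fun ω =>
    mul_nonneg (h.step_pos k).le (sq_nonneg _))
    (fun k => (h.memLp_stationarity k).integrable_sq.const_mul _) ?_
  simpa only [integral_const_mul] using h.exists_integral_merit_le_and_summable.2

lemma ae_summable_sq_mul_noise_sq (h : StochasticDescent μ ℱ e a s α c κ) :
    ∀ᵐ ω ∂μ, Summable fun k => α k ^ 2 * s k ω ^ 2 := by
  obtain ⟨M, hM⟩ := h.exists_integral_merit_le_and_summable.1
  refine ae_summable_of_summable_integral (fun k => Eventually.of_forall fun ω => by positivity)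
    (fun k => (h.memLp_noise k).integrable_sq.const_mul _) ?_
  simp only [integral_const_mul]
  exact (h.summable_step_sq.mul_right (c * M)).of_nonneg_of_le
    (fun k => mul_nonneg (sq_nonneg _) (integral_nonneg fun ω => sq_nonneg _))
    fun k => mul_le_mul_of_nonneg_left (h.integral_noise_sq_le (hM k)) (sq_nonneg _)

/- Dividing by the merit makes the weight `a k ^ 2 / e k` bounded, so that it may be multiplied
with the conditional second moment bound on the noise, which is only of order `e k`. -/
lemma ae_summable_mul_stationarity_sq_div_merit_mul_noise_sq
    (h : StochasticDescent μ ℱ e a s α c κ) :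
    ∀ᵐ ω ∂μ, Summable fun k => α k * (a k ω ^ 2 / e k ω * s k ω ^ 2) := by
  have hm : ∀ k, StronglyMeasurable[ℱ k] fun ω => a k ω ^ 2 / e k ω := fun k =>
    (((h.stronglyMeasurable_stationarity k).pow 2).measurable.div
      (h.stronglyMeasurable_merit k).measurable).stronglyMeasurable
  have hnonneg : ∀ k ω, 0 ≤ a k ω ^ 2 / e k ω := fun k ω =>
    div_nonneg (sq_nonneg _) (h.merit_pos k ω).le
  have hle : ∀ k ω, a k ω ^ 2 / e k ω ≤ c := fun k ω =>
    (div_le_iff₀ (h.merit_pos k ω)).2 (h.stationarity_sq_le k ω)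
  have hint : ∀ k, ∫ ω, a k ω ^ 2 / e k ω * s k ω ^ 2 ∂μ ≤ c * ∫ ω, a k ω ^ 2 ∂μ := fun k =>
    calc ∫ ω, a k ω ^ 2 / e k ω * s k ω ^ 2 ∂μ ≤ ∫ ω, a k ω ^ 2 / e k ω * (c * e k ω) ∂μ :=
          integral_mul_le_of_condExp_le (ℱ.le k) (hm k) (hnonneg k) (hle k)
            (h.memLp_noise k).integrable_sq ((h.integrable_merit k).const_mul c)
            (h.condExp_noise_sq_le k)
      _ = ∫ ω, c * a k ω ^ 2 ∂μ := integral_congr_ae <| Eventually.of_forall fun ω => by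
          have hne := (h.merit_pos k ω).ne'
          simp only
          field_simp
      _ = c * ∫ ω, a k ω ^ 2 ∂μ := integral_const_mul _ _
  have hterm : ∀ k ω, 0 ≤ a k ω ^ 2 / e k ω * s k ω ^ 2 := fun k ω =>
    mul_nonneg (hnonneg k ω) (sq_nonneg _)
  refine ae_summable_of_summable_integral (fun k => Eventually.of_forall fun ω =>
    mul_nonneg (h.step_pos k).le (hterm k ω)) (fun k => ?_) ?_
  · refine ((h.memLp_noise k).integrable_sq.bdd_mul (c := c)
      ((hm k).mono (ℱ.le k)).aestronglyMeasurable (Eventually.of_forall fun ω => ?_)).const_mul _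
    exact (Real.norm_of_nonneg (hnonneg k ω)).trans_le (hle k ω)
  · simp only [integral_const_mul]
    refine (h.exists_integral_merit_le_and_summable.2.mul_left c).of_nonneg_of_le
      (fun k => mul_nonneg (h.step_pos k).le (integral_nonneg (hterm k))) fun k => ?_
    exact (mul_le_mul_of_nonneg_left (hint k) (h.step_pos k).le).trans_eq (by ring)

theorem ae_tendsto_stationarity (h : StochasticDescent μ ℱ e a s α c κ) :
    ∀ᵐ ω ∂μ, Tendsto (fun k => a k ω) atTop (𝓝 0) := by
  filter_upwards [h.ae_exists_forall_merit_le, h.ae_summable_mul_stationarity_sq,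
    h.ae_summable_sq_mul_noise_sq, h.ae_summable_mul_stationarity_sq_div_merit_mul_noise_sq,
    ae_all_iff.2 h.abs_stationarity_sub_le] with ω ⟨M, hM⟩ hstat hnoise hcross hstep
  have hd0 : ∀ k, 0 ≤ c * α k * (s k ω + 1) := fun k =>
    mul_nonneg (h.const_mul_step_nonneg k) (add_nonneg (h.noise_nonneg k ω) zero_le_one)
  refine tendsto_zero_of_summable_mul_sq (d := fun k => c * α k * (s k ω + 1))
    (fun k => (h.step_pos k).le) h.not_summable_step (fun k => h.stationarity_nonneg k ω)
    (fun k => h.stationarity_le_one_add (hM k)) hstep ?_ ?_ hstat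
  · refine ((hnoise.add h.summable_step_sq).mul_left (2 * c ^ 2)).of_nonneg_of_le
      (fun k => sq_nonneg _) fun k => ?_
    calc (c * α k * (s k ω + 1)) ^ 2 = (c * α k) ^ 2 * (s k ω + 1) ^ 2 := mul_pow _ _ _
      _ ≤ (c * α k) ^ 2 * (2 * (s k ω ^ 2 + 1)) := by
          gcongr
          linarith [two_mul_le_add_sq (s k ω) 1]
      _ = 2 * c ^ 2 * (α k ^ 2 * s k ω ^ 2 + α k ^ 2) := by ring
  · refine (((hcross.mul_left M).add (hstat.mul_left 2)).mul_left c).of_nonneg_of_le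
      (fun k => mul_nonneg (hd0 k) (sq_nonneg _)) fun k => ?_
    calc c * α k * (s k ω + 1) * a k ω ^ 2 = c * α k * ((s k ω + 1) * a k ω ^ 2) := mul_assoc _ _ _
      _ ≤ c * α k * (M * (a k ω ^ 2 / e k ω * s k ω ^ 2) + 2 * a k ω ^ 2) :=
          mul_le_mul_of_nonneg_left (h.noise_mul_stationarity_sq_le (hM k))
            (h.const_mul_step_nonneg k)
      _ = c * (M * (α k * (a k ω ^ 2 / e k ω * s k ω ^ 2)) + 2 * (α k * a k ω ^ 2)) := by ring

end StochasticDescent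

section RandomPoint

lemma apply_eq_sum_indicator {Ω E : Type*} (D : Ω → E → ℝ) {S : Ω → E}
    (hS : (Set.range S).Finite) (ω : Ω) :
    D ω (S ω) = ∑ y ∈ hS.toFinset, (S ⁻¹' {y}).indicator (fun ω => D ω y) ω := by
  classical
  have hfiber : ∀ y, (S ⁻¹' {y}).indicator (fun ω => D ω y) ω = if S ω = y then D ω y else 0 :=
    fun y => Set.indicator_apply _ _ _
  simp_rw [hfiber]
  rw [Finset.sum_ite_eq, if_pos (hS.mem_toFinset.2 (Set.mem_range_self ω))]

variable {Ω : Type*} {m : MeasurableSpace Ω} [mΩ : MeasurableSpace Ω] {μ : Measure Ω}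

lemma condExp_nonpos_iff_forall_setIntegral_nonpos (hm : m ≤ mΩ) [SigmaFinite (μ.trim hm)]
    {X : Ω → ℝ} (hX : Integrable X μ) :
    μ[X | m] ≤ᵐ[μ] 0 ↔ ∀ A, MeasurableSet[m] A → ∫ ω in A, X ω ∂μ ≤ 0 := by
  constructor
  · intro h A hA
    rw [← setIntegral_condExp hm hX hA]
    exact integral_nonpos_of_ae (ae_restrict_of_ae h)
  · intro h
    refine ae_le_of_ae_le_trim (hm := hm) (ae_le_of_forall_setIntegral_le
      (integrable_condExp.trim hm stronglyMeasurable_condExp) (integrable_zero _ _ _)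
      fun A hA _ => ?_)
    rw [← setIntegral_trim hm stronglyMeasurable_condExp hA, setIntegral_condExp hm hX hA]
    simpa only [Pi.zero_apply, integral_zero] using h A hA

lemma integrable_and_integral_le_of_tendsto {X : ℕ → Ω → ℝ} {Y : Ω → ℝ} {c : ℝ}
    (hX0 : ∀ j, 0 ≤ᵐ[μ] X j) (hXi : ∀ j, Integrable (X j) μ)
    (hlim : ∀ᵐ ω ∂μ, Tendsto (fun j => X j ω) atTop (𝓝 (Y ω))) (hle : ∀ j, ∫ ω, X j ω ∂μ ≤ c) :
    Integrable Y μ ∧ ∫ ω, Y ω ∂μ ≤ c := by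
  have hY0 : 0 ≤ᵐ[μ] Y := by
    filter_upwards [hlim, ae_all_iff.2 hX0] with ω hω hω0 using ge_of_tendsto' hω hω0
  have hc : 0 ≤ c := (integral_nonneg_of_ae (hX0 0)).trans (hle 0)
  have hfatou : ∫⁻ ω, ENNReal.ofReal (Y ω) ∂μ ≤ ENNReal.ofReal c :=
    calc ∫⁻ ω, ENNReal.ofReal (Y ω) ∂μ
        = ∫⁻ ω, liminf (fun j => ENNReal.ofReal (X j ω)) atTop ∂μ := by
          refine lintegral_congr_ae ?_
          filter_upwards [hlim] with ω hω
          exact ((ENNReal.continuous_ofReal.tendsto _).comp hω).liminf_eq.symm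
      _ ≤ liminf (fun j => ∫⁻ ω, ENNReal.ofReal (X j ω) ∂μ) atTop :=
          lintegral_liminf_le' fun j => (hXi j).aemeasurable.ennreal_ofReal
      _ ≤ liminf (fun _ : ℕ => ENNReal.ofReal c) atTop := by
          refine liminf_le_liminf (Eventually.of_forall fun j => ?_)
          rw [← ofReal_integral_eq_lintegral_ofReal (hXi j) (hX0 j)]
          exact ENNReal.ofReal_le_ofReal (hle j)
      _ = ENNReal.ofReal c := liminf_const _
  have hYi : Integrable Y μ := by
    refine ⟨aestronglyMeasurable_of_tendsto_ae atTop
      (fun j => (hXi j).aestronglyMeasurable) hlim, ?_⟩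
    rw [hasFiniteIntegral_iff_ofReal hY0]
    exact hfatou.trans_lt ENNReal.ofReal_lt_top
  rw [← ofReal_integral_eq_lintegral_ofReal hYi hY0] at hfatou
  exact ⟨hYi, (ENNReal.ofReal_le_ofReal_iff hc).1 hfatou⟩

variable {E : Type*} {D : Ω → E → ℝ}

lemma exists_finite_range_approx {Ω : Type*} {_ : MeasurableSpace Ω} [PseudoMetricSpace E]
    [SecondCountableTopology E] [MeasurableSpace E] [OpensMeasurableSpace E] {K : Set E} {y₀ : E}
    (hy₀ : y₀ ∈ K) {Y : Ω → E} (hY : Measurable Y) (hYK : ∀ ω, Y ω ∈ K) :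
    ∃ S : ℕ → Ω → E, (∀ j, (Set.range (S j)).Finite) ∧ (∀ j y, MeasurableSet (S j ⁻¹' {y})) ∧
      (∀ j ω, S j ω ∈ K) ∧ (∀ j ω, dist (S j ω) y₀ ≤ 2 * dist (Y ω) y₀) ∧
      ∀ ω, Tendsto (fun j => S j ω) atTop (𝓝 (Y ω)) := by
  refine ⟨fun j => SimpleFunc.approxOn Y hY K y₀ hy₀ j, fun j => SimpleFunc.finite_range _,
    fun j => SimpleFunc.measurableSet_fiber _, fun j => SimpleFunc.approxOn_mem hY hy₀ j,
    fun j ω => ?_, fun ω => SimpleFunc.tendsto_approxOn hY hy₀ (subset_closure (hYK ω))⟩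
  have hedist := SimpleFunc.edist_approxOn_y0_le hY hy₀ ω j
  rw [edist_dist, edist_dist, ← ENNReal.ofReal_add dist_nonneg dist_nonneg,
    ENNReal.ofReal_le_ofReal_iff (by positivity), ← two_mul] at hedist
  rwa [dist_comm, dist_comm (Y ω)]

lemma integrable_apply_of_finite_range {S : Ω → E} (hS : (Set.range S).Finite)
    (hSm : ∀ y, MeasurableSet (S ⁻¹' {y})) (hD : ∀ ω, Integrable (fun ω' => D ω' (S ω)) μ) :
    Integrable (fun ω => D ω (S ω)) μ := by
  simp_rw [apply_eq_sum_indicator D hS]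
  refine integrable_finsetSum _ fun y hy => ?_
  obtain ⟨ω, rfl⟩ := hS.mem_toFinset.1 hy
  exact (hD ω).indicator (hSm _)

lemma setIntegral_apply_nonpos_of_finite_range (hm : m ≤ mΩ) {S : Ω → E}
    (hS : (Set.range S).Finite) (hSm : ∀ y, MeasurableSet[m] (S ⁻¹' {y}))
    (hDi : ∀ ω, Integrable (fun ω' => D ω' (S ω)) μ)
    (hD : ∀ ω A, MeasurableSet[m] A → ∫ ω' in A, D ω' (S ω) ∂μ ≤ 0)
    {A : Set Ω} (hA : MeasurableSet[m] A) : ∫ ω in A, D ω (S ω) ∂μ ≤ 0 := by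
  simp_rw [apply_eq_sum_indicator D hS]
  rw [integral_finsetSum]
  · refine Finset.sum_nonpos fun y hy => ?_
    obtain ⟨ω, rfl⟩ := hS.mem_toFinset.1 hy
    rw [setIntegral_indicator (hm _ (hSm _))]
    exact hD ω _ (hA.inter (hSm _))
  · intro y hy
    obtain ⟨ω, rfl⟩ := hS.mem_toFinset.1 hy
    exact ((hDi ω).indicator (hm _ (hSm _))).integrableOn

lemma integrable_and_condExp_apply_nonpos [PseudoMetricSpace E] [SecondCountableTopology E]
    [MeasurableSpace E] [OpensMeasurableSpace E] (hm : m ≤ mΩ) [SigmaFinite (μ.trim hm)]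
    {K : Set E} {y₀ : E} (hy₀ : y₀ ∈ K) (hDi : ∀ y ∈ K, Integrable (fun ω => D ω y) μ)
    (hD : ∀ y ∈ K, μ[fun ω => D ω y | m] ≤ᵐ[μ] 0) (hcont : ∀ᵐ ω ∂μ, ContinuousOn (D ω) K)
    {Y : Ω → E} (hY : Measurable[m] Y) (hYK : ∀ ω, Y ω ∈ K) {T : Ω → ℝ} (hT : Integrable T μ)
    (hlow : ∀ᵐ ω ∂μ, ∀ y ∈ K, dist y y₀ ≤ 2 * dist (Y ω) y₀ → -T ω ≤ D ω y) :
    Integrable (fun ω => D ω (Y ω)) μ ∧ μ[fun ω => D ω (Y ω) | m] ≤ᵐ[μ] 0 := by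
  obtain ⟨S, hSfin, hSm, hSK, hSdist, hSlim⟩ := exists_finite_range_approx hy₀ hY hYK
  have hSi : ∀ j, Integrable (fun ω => D ω (S j ω)) μ := fun j =>
    integrable_apply_of_finite_range (hSfin j) (fun y => hm _ (hSm j y))
      fun ω => hDi _ (hSK j ω)
  have hSle : ∀ j A, MeasurableSet[m] A → ∫ ω in A, D ω (S j ω) ∂μ ≤ 0 := fun j A hA =>
    setIntegral_apply_nonpos_of_finite_range hm (hSfin j) (hSm j) (fun ω => hDi _ (hSK j ω))
      (fun ω => (condExp_nonpos_iff_forall_setIntegral_nonpos hm (hDi _ (hSK j ω))).1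
        (hD _ (hSK j ω))) hA
  have hlim : ∀ᵐ ω ∂μ, Tendsto (fun j => D ω (S j ω) + T ω) atTop (𝓝 (D ω (Y ω) + T ω)) := by
    filter_upwards [hcont] with ω hω
    exact ((hω (Y ω) (hYK ω)).tendsto.comp (tendsto_nhdsWithin_iff.2
      ⟨hSlim ω, Eventually.of_forall fun j => hSK j ω⟩)).add_const _
  have hnonneg : ∀ j, 0 ≤ᵐ[μ] fun ω => D ω (S j ω) + T ω := fun j => by
    filter_upwards [hlow] with ω hω
    exact neg_le_iff_add_nonneg.1 (hω _ (hSK j ω) (hSdist j ω))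
  have hfatou : ∀ A, MeasurableSet[m] A → IntegrableOn (fun ω => D ω (Y ω) + T ω) A μ ∧
      ∫ ω in A, (D ω (Y ω) + T ω) ∂μ ≤ ∫ ω in A, T ω ∂μ := by
    intro A hA
    refine integrable_and_integral_le_of_tendsto (fun j => ae_restrict_of_ae (hnonneg j))
      (fun j => ((hSi j).add hT).integrableOn) (ae_restrict_of_ae hlim) fun j => ?_
    rw [integral_add (hSi j).integrableOn hT.integrableOn]
    exact add_le_of_nonpos_left (hSle j A hA)
  have hYi : Integrable (fun ω => D ω (Y ω)) μ :=
    (integrable_add_iff_integrable_left hT).1 (integrableOn_univ.1 (hfatou _ MeasurableSet.univ).1)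
  refine ⟨hYi, (condExp_nonpos_iff_forall_setIntegral_nonpos hm hYi).2 fun A hA => ?_⟩
  have hle := (hfatou A hA).2
  rwa [integral_add hYi.integrableOn hT.integrableOn, add_le_iff_nonpos_left] at hle

end RandomPoint

section EnvelopeMerit

variable {E : Type*} [NormedAddCommGroup E] {f : E → ℝ} {φ : E → EReal} {ρ b bφ m θ : ℝ}
  {A L : ℝ≥0}

/-- The Lyapunov function of the method: the Moreau envelope of `h`, normalized by a lower bound
`c` of `h` so that it takes values in `[1, ∞)`. -/
noncomputable def envelopeMerit (θ : ℝ) (h : E → EReal) (c : ℝ) (x : E) : ℝ :=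
  1 + (moreauEnv θ h x - c)

variable [InnerProductSpace ℝ E]

lemma IsRegularizer.add_le_toReal_compositeObj (hφ : IsRegularizer φ ρ L bφ)
    (hf : HasQuadraticGapGrowth f (effDom φ) b A) :
    ∀ y ∈ effDom (compositeObj f φ), b + bφ ≤ (compositeObj f φ y).toReal := fun y hy => by
  rw [effDom_compositeObj] at hy
  rw [toReal_compositeObj hφ.proper hy]
  exact add_le_add (hf.le y hy) (hφ.le_toReal hy)

lemma IsRegularizer.sub_add_norm_sub_sq_le_moreauEnv (hφ : IsRegularizer φ ρ L bφ) {x p : E}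
    (hp : IsProx θ (compositeObj f φ) x p) :
    f p - b + 1 / (2 * θ) * ‖p - x‖ ^ 2 ≤ moreauEnv θ (compositeObj f φ) x - (b + bφ) := by
  have hmem := hφ.mem_effDom_of_isProx hp
  rw [hp.moreauEnv_eq (properFunction_compositeObj hφ.proper), toReal_compositeObj hφ.proper hmem]
  linarith [hφ.le_toReal hmem]

section Merit

variable [CompleteSpace E] (hφ : IsRegularizer φ ρ L bφ)
  (hf : HasQuadraticGapGrowth f (effDom φ) b A) (hψ : WeaklyConvex m (compositeObj f φ))
  (hθ : 0 < θ) (hm : θ * m < 1)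

include hφ hf hψ hθ hm

lemma one_le_envelopeMerit (x : E) : 1 ≤ envelopeMerit θ (compositeObj f φ) (b + bφ) x := by
  obtain ⟨p, hp⟩ := hφ.exists_isProx_compositeObj hf hψ hθ hm x
  have hgap := sub_nonneg.2 (hf.le p (hφ.mem_effDom_of_isProx hp))
  exact le_add_of_nonneg_right (le_trans (by positivity) (hφ.sub_add_norm_sub_sq_le_moreauEnv hp))

lemma sub_le_mul_envelopeMerit {x : E} (hx : x ∈ effDom φ) :
    f x - b ≤ A * (1 + 2 * θ) * envelopeMerit θ (compositeObj f φ) (b + bφ) x := by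
  obtain ⟨p, hp⟩ := hφ.exists_isProx_compositeObj hf hψ hθ hm x
  have hmem := hφ.mem_effDom_of_isProx hp
  have hgap := sub_nonneg.2 (hf.le p hmem)
  have henv := hφ.sub_add_norm_sub_sq_le_moreauEnv (b := b) hp
  rw [mul_assoc]
  refine (hf.gap_le x hx p hmem).trans (mul_le_mul_of_nonneg_left ?_ A.coe_nonneg)
  calc 1 + (f p - b) + ‖x - p‖ ^ 2
      ≤ (1 + 2 * θ) * (1 + (f p - b + 1 / (2 * θ) * ‖p - x‖ ^ 2)) := by
        have hmul : 2 * θ * (1 / (2 * θ) * ‖p - x‖ ^ 2) = ‖p - x‖ ^ 2 := by field_simp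
        have hrest : 0 ≤ 2 * θ + 2 * θ * (f p - b) + 1 / (2 * θ) * ‖p - x‖ ^ 2 := by positivity
        rw [norm_sub_rev x p]
        linarith
    _ ≤ (1 + 2 * θ) * envelopeMerit θ (compositeObj f φ) (b + bφ) x := by
        unfold envelopeMerit
        gcongr

lemma differentiable_moreauEnv_compositeObj :
    Differentiable ℝ (moreauEnv θ (compositeObj f φ)) := by
  choose P hP using hφ.exists_isProx_compositeObj hf hψ hθ hm
  exact fun x => (IsProx.hasGradientAt_moreauEnv hP (properFunction_compositeObj hφ.proper)
    hψ hθ hm x).differentiableAt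

lemma lipschitzWith_gradient_moreauEnv_compositeObj :
    LipschitzWith (‖1 / θ‖₊ * (1 + (1 - θ * m)⁻¹.toNNReal))
      (gradient (moreauEnv θ (compositeObj f φ))) := by
  choose P hP using hφ.exists_isProx_compositeObj hf hψ hθ hm
  exact IsProx.lipschitzWith_gradient_moreauEnv hP (properFunction_compositeObj hφ.proper) hψ hθ hm

lemma continuous_envelopeMerit :
    Continuous (envelopeMerit θ (compositeObj f φ) (b + bφ)) :=
  continuous_const.add ((differentiable_moreauEnv_compositeObj hφ hf hψ hθ hm).continuous.sub
    continuous_const)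

lemma norm_gradient_moreauEnv_sq_le_mul_envelopeMerit (x : E) :
    ‖gradient (moreauEnv θ (compositeObj f φ)) x‖ ^ 2
      ≤ 2 / θ * envelopeMerit θ (compositeObj f φ) (b + bφ) x := by
  choose P hP using hφ.exists_isProx_compositeObj hf hψ hθ hm
  refine (IsProx.norm_gradient_moreauEnv_sq_le hP (properFunction_compositeObj hφ.proper) hψ
    (hφ.add_le_toReal_compositeObj hf) hθ hm x).trans ?_
  unfold envelopeMerit
  gcongr
  exact le_add_of_nonneg_left zero_le_one

lemma integrable_envelopeMerit_comp {Ω : Type*} [MeasurableSpace Ω] {μ : Measure Ω}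
    [IsFiniteMeasure μ] {X : Ω → E} (hX : MemLp X 2 μ) :
    Integrable (fun ω => envelopeMerit θ (compositeObj f φ) (b + bφ) (X ω)) μ := by
  have hproper := properFunction_compositeObj (H := f) hφ.proper
  obtain ⟨y, hy⟩ := hproper.nonempty
  have hbound : Integrable (fun ω => 1 + ((compositeObj f φ y).toReal
      + 1 / (2 * θ) * ‖y - X ω‖ ^ 2 - (b + bφ))) μ :=
    (integrable_const _).add (((integrable_const _).add
      ((integrable_norm_sub_sq (memLp_const y) hX).const_mul _)).sub
      (integrable_const _))
  refine hbound.mono' ((continuous_envelopeMerit hφ hf hψ hθ hm).comp_aestronglyMeasurable hX.1)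
    (Eventually.of_forall fun ω => ?_)
  obtain ⟨p, hp⟩ := hφ.exists_isProx_compositeObj hf hψ hθ hm (X ω)
  rw [Real.norm_of_nonneg (zero_le_one.trans (one_le_envelopeMerit hφ hf hψ hθ hm _))]
  unfold envelopeMerit
  gcongr
  exact hp.moreauEnv_le hproper hy

end Merit

end EnvelopeMerit

section Method

variable {Ω : Type*} [mΩ : MeasurableSpace Ω] {μ : Measure Ω} {ℱ : Filtration ℕ mΩ}
  {E : Type*} [NormedAddCommGroup E] [InnerProductSpace ℝ E] [MeasurableSpace E]

/-- The stochastic model-based method for minimizing `f + φ`: `F k ω` is the random model of `f`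
used in step `k`, `g k ω` a subgradient of it at the iterate `x k ω`, and `α` are the step sizes.
The fields are the update rule together with assumptions (E.1), (E.2), (E.3) and (E.5); the initial
point may be random, and the models are required to be continuous on the domain of `φ`. -/
structure IsModelMethod (μ : Measure Ω) (ℱ : Filtration ℕ mΩ) (f : E → ℝ) (φ : E → EReal)
    (F : ℕ → Ω → E → ℝ) (x g : ℕ → Ω → E) (α : ℕ → ℝ) (η τ C D b : ℝ) : Prop where
  measurable : ∀ k, Measurable[ℱ k] (x k)
  memLp_zero : MemLp (x 0) 2 μ
  isProx : ∀ k, ∀ᵐ ω ∂μ, IsProx (α k) (compositeObj (F k ω) φ) (x k ω) (x (k + 1) ω)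
  integrable_self : ∀ k, Integrable (fun ω => F k ω (x k ω)) μ
  condExp_self : ∀ k, μ[fun ω => F k ω (x k ω) | ℱ k] =ᵐ[μ] fun ω => f (x k ω)
  integrable : ∀ k, ∀ y ∈ effDom φ, Integrable (fun ω => F k ω y) μ
  condExp_sub_le : ∀ k, ∀ y ∈ effDom φ,
    μ[fun ω => F k ω y - f y | ℱ k] ≤ᵐ[μ] fun ω => τ / 2 * ‖x k ω - y‖ ^ 2
  weaklyConvex : ∀ k, ∀ᵐ ω ∂μ, WeaklyConvex η fun y => (F k ω y : EReal)
  continuousOn : ∀ k, ∀ᵐ ω ∂μ, ContinuousOn (F k ω) (effDom φ)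
  mem_frechetSubdiff : ∀ k, ∀ᵐ ω ∂μ, g k ω ∈ frechetSubdiff (F k ω) (x k ω)
  memLp_subgradient : ∀ k, MemLp (g k) 2 μ
  condExp_norm_subgradient_sq_le : ∀ k,
    μ[fun ω => ‖g k ω‖ ^ 2 | ℱ k] ≤ᵐ[μ] fun ω => C * (f (x k ω) - b) + D
  step_pos : ∀ k, 0 < α k
  step_mul_lt_one : ∀ k, α k * η < 1
  not_summable_step : ¬ Summable α
  summable_step_sq : Summable fun k => α k ^ 2

namespace IsModelMethod

variable {f : E → ℝ} {φ : E → EReal} {F : ℕ → Ω → E → ℝ} {x g : ℕ → Ω → E} {α : ℕ → ℝ}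
  {η τ ρ C D b bφ θ : ℝ} {A L : ℝ≥0}

lemma ae_mem_effDom (hM : IsModelMethod μ ℱ f φ F x g α η τ C D b)
    (hφ : IsRegularizer φ ρ L bφ) (k : ℕ) : ∀ᵐ ω ∂μ, x (k + 1) ω ∈ effDom φ := by
  filter_upwards [hM.isProx k] with ω hp using hφ.mem_effDom_of_isProx hp

lemma tendsto_step (hM : IsModelMethod μ ℱ f φ F x g α η τ C D b) :
    Tendsto α atTop (𝓝 0) := by
  have hsqrt := hM.summable_step_sq.tendsto_atTop_zero.sqrt
  simpa only [Real.sqrt_zero, Real.sqrt_sq (hM.step_pos _).le] using hsqrt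

lemma eventually_abs_step_mul_le_half (hM : IsModelMethod μ ℱ f φ F x g α η τ C D b) (c : ℝ) :
    ∀ᶠ k in atTop, |α k * c| ≤ 1 / 2 := by
  have hlim := (hM.tendsto_step.mul_const c).abs
  rw [zero_mul, abs_zero] at hlim
  exact hlim.eventually_le_const one_half_pos

lemma aestronglyMeasurable_iterate [BorelSpace E] [SecondCountableTopology E]
    (hM : IsModelMethod μ ℱ f φ F x g α η τ C D b) (k : ℕ) : AEStronglyMeasurable (x k) μ :=
  ((hM.measurable k).mono (ℱ.le k) le_rfl).aestronglyMeasurable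

lemma memLp_iterate [IsFiniteMeasure μ] [BorelSpace E] [SecondCountableTopology E]
    (hM : IsModelMethod μ ℱ f φ F x g α η τ C D b) (hφ : IsRegularizer φ ρ L bφ) (k : ℕ) :
    MemLp (x k) 2 μ := by
  induction k with
  | zero => exact hM.memLp_zero
  | succ k ih =>
    obtain ⟨y, hy⟩ := hφ.proper.nonempty
    have hmod : 0 < (1 / α k - η) / 4 := by
      have := hM.step_mul_lt_one k
      rw [← lt_div_iff₀' (hM.step_pos k), ← sub_pos] at this
      positivity
    have hmeas := (hM.aestronglyMeasurable_iterate (k + 1)).sub ih.1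
    have hbound : Integrable (fun ω => ((1 / α k - η) / 4)⁻¹ * (F k ω y - F k ω (x k ω)
        + (φ y).toReal - bφ + 1 / (2 * α k) * ‖y - x k ω‖ ^ 2
        + ‖g k ω‖ ^ 2 / (1 / α k - η))) μ :=
      ((((((hM.integrable k y hy).sub (hM.integrable_self k)).add (integrable_const _)).sub
        (integrable_const _)).add ((integrable_norm_sub_sq (memLp_const y) ih).const_mul _)).add
        (((hM.memLp_subgradient k).integrable_norm_pow two_ne_zero).div_const _)).const_mul _
    have hstep : MemLp (fun ω => x (k + 1) ω - x k ω) 2 μ := by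
      refine (memLp_two_iff_integrable_sq_norm hmeas).2 (hbound.mono' (hmeas.norm.pow 2) ?_)
      filter_upwards [hM.weaklyConvex k, hM.mem_frechetSubdiff k, hM.isProx k] with ω hH hg hp
      rw [Real.norm_of_nonneg (sq_nonneg _), inv_mul_eq_div, le_div_iff₀' hmod]
      exact hφ.mul_norm_step_sq_le hH hg hp (hM.step_pos k) (hM.step_mul_lt_one k) hy
    exact (hstep.add ih).ae_eq (Eventually.of_forall fun ω => sub_add_cancel _ _)

end IsModelMethod

end Method

section Accuracy

variable {E : Type*} [NormedAddCommGroup E] [InnerProductSpace ℝ E]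

lemma neg_le_model_sub_mul_norm_sq {H : E → ℝ} {x y g : E} {η r : ℝ} (τ : ℝ)
    (hH : WeaklyConvex η fun y => (H y : EReal)) (hg : g ∈ frechetSubdiff H x)
    (hr : ‖x - y‖ ≤ r) :
    -(|H x| + ‖g‖ ^ 2 + (1 + |η| / 2 + |τ| / 2) * r ^ 2) ≤ H y - τ / 2 * ‖x - y‖ ^ 2 := by
  have hsub := add_inner_add_mul_le_of_mem_frechetSubdiff
    (weaklyConvex_coe_iff_strongConvexOn.1 hH) hg (Set.mem_univ x) (Set.mem_univ y)
  have hcs := neg_le_of_abs_le (abs_real_inner_le_norm g (y - x))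
  rw [norm_sub_rev y x] at hsub hcs
  have hr2 : ‖x - y‖ ^ 2 ≤ r ^ 2 := pow_le_pow_left₀ (norm_nonneg _) hr 2
  have hyoung : ‖g‖ * ‖x - y‖ ≤ ‖g‖ ^ 2 + r ^ 2 := by
    linarith [two_mul_le_add_sq ‖g‖ ‖x - y‖, sq_nonneg ‖g‖, sq_nonneg ‖x - y‖]
  have hη : η * ‖x - y‖ ^ 2 ≤ |η| * r ^ 2 :=
    mul_le_mul (le_abs_self η) hr2 (sq_nonneg _) (abs_nonneg η)
  have hτ : τ * ‖x - y‖ ^ 2 ≤ |τ| * r ^ 2 :=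
    mul_le_mul (le_abs_self τ) hr2 (sq_nonneg _) (abs_nonneg τ)
  linarith [neg_abs_le (H x)]

namespace IsModelMethod

variable [MeasurableSpace E] [BorelSpace E] [SecondCountableTopology E]
  {Ω : Type*} [mΩ : MeasurableSpace Ω] {μ : Measure Ω} [IsFiniteMeasure μ] {ℱ : Filtration ℕ mΩ}
  {f : E → ℝ} {φ : E → EReal} {F : ℕ → Ω → E → ℝ} {x g : ℕ → Ω → E} {α : ℕ → ℝ}
  {η τ ρ C D b bφ : ℝ} {A L : ℝ≥0}

lemma condExp_accuracy_nonpos (hM : IsModelMethod μ ℱ f φ F x g α η τ C D b)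
    (hφ : IsRegularizer φ ρ L bφ) (k : ℕ) {y : E} (hy : y ∈ effDom φ) :
    μ[fun ω => F k ω y - f y - τ / 2 * ‖x k ω - y‖ ^ 2 | ℱ k] ≤ᵐ[μ] 0 := by
  have hquad : Integrable (fun ω => τ / 2 * ‖x k ω - y‖ ^ 2) μ :=
    (integrable_norm_sub_sq (hM.memLp_iterate hφ k) (memLp_const y)).const_mul _
  have hmeas : StronglyMeasurable[ℱ k] fun ω => τ / 2 * ‖x k ω - y‖ ^ 2 :=
    (((hM.measurable k).stronglyMeasurable.sub stronglyMeasurable_const).norm.pow 2).const_mul _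
  have hsub := condExp_sub ((hM.integrable k y hy).sub (integrable_const (f y))) hquad (ℱ k)
  rw [condExp_of_stronglyMeasurable (ℱ.le k) hmeas hquad] at hsub
  filter_upwards [hsub, hM.condExp_sub_le k y hy] with ω hω hacc
  exact hω.trans_le (sub_nonpos.2 hacc)

lemma integrable_and_condExp_accuracy_nonpos (hM : IsModelMethod μ ℱ f φ F x g α η τ C D b)
    (hφ : IsRegularizer φ ρ L bφ) (hf : HasQuadraticGapGrowth f (effDom φ) b A) (k : ℕ)
    {Y : Ω → E} (hY : Measurable[ℱ k] Y) (hYφ : ∀ ω, Y ω ∈ effDom φ) (hY2 : MemLp Y 2 μ) :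
    Integrable (fun ω => F k ω (Y ω) - f (Y ω) - τ / 2 * ‖x k ω - Y ω‖ ^ 2) μ ∧
      μ[fun ω => F k ω (Y ω) - f (Y ω) - τ / 2 * ‖x k ω - Y ω‖ ^ 2 | ℱ k] ≤ᵐ[μ] 0 := by
  obtain ⟨y₀, hy₀⟩ := hφ.proper.nonempty
  have hx2 := hM.memLp_iterate hφ k
  let r : Ω → ℝ := fun ω => ‖x k ω - y₀‖ + 2 * ‖Y ω - y₀‖
  let fsup : Ω → ℝ := fun ω => b + A * (1 + (f y₀ - b) + (2 * ‖Y ω - y₀‖) ^ 2)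
  have hYdist : MemLp (fun ω => 2 * ‖Y ω - y₀‖) 2 μ := (hY2.sub (memLp_const y₀)).norm.const_mul 2
  have hr : MemLp r 2 μ := (hx2.sub (memLp_const y₀)).norm.add hYdist
  have hfsup : Integrable fsup μ := (integrable_const b).add
    (((integrable_const _).add hYdist.integrable_sq).const_mul _)
  have hbound : Integrable (fun ω => |F k ω (x k ω)| + ‖g k ω‖ ^ 2
      + (1 + |η| / 2 + |τ| / 2) * r ω ^ 2 + fsup ω) μ :=
    (((hM.integrable_self k).abs.add ((hM.memLp_subgradient k).integrable_norm_pow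
      two_ne_zero)).add (hr.integrable_sq.const_mul _)).add hfsup
  refine integrable_and_condExp_apply_nonpos
    (D := fun ω y => F k ω y - f y - τ / 2 * ‖x k ω - y‖ ^ 2) (ℱ.le k) hy₀
    (fun y hy => ((hM.integrable k y hy).sub (integrable_const _)).sub
      ((integrable_norm_sub_sq hx2 (memLp_const y)).const_mul _))
    (fun y hy => hM.condExp_accuracy_nonpos hφ k hy) ?_ hY hYφ hbound ?_
  · filter_upwards [hM.continuousOn k] with ω hω
    exact (hω.sub hf.continuousOn).sub (by fun_prop)
  · filter_upwards [hM.weaklyConvex k, hM.mem_frechetSubdiff k] with ω hH hg y hy hdist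
    rw [dist_eq_norm, dist_eq_norm] at hdist
    have hxy : ‖x k ω - y‖ ≤ r ω := by
      refine (norm_sub_le_norm_sub_add_norm_sub _ y₀ _).trans ?_
      rw [norm_sub_rev y₀]
      exact add_le_add_right hdist _
    have hfy : f y ≤ fsup ω := by
      have hgap := hf.gap_le y hy y₀ hy₀
      have hsq := pow_le_pow_left₀ (norm_nonneg _) hdist 2
      linarith [mul_le_mul_of_nonneg_left hsq A.coe_nonneg]
    linarith [neg_le_model_sub_mul_norm_sq τ hH hg hxy]

end IsModelMethod

end Accuracy

section Descent

lemma two_thirds_mul_le_div_one_sub {a u : ℝ} (ha : 0 ≤ a) (hu : |u| ≤ 1 / 2) :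
    2 / 3 * a ≤ a / (1 - u) := by
  obtain ⟨hlow, hup⟩ := abs_le.1 hu
  rw [le_div_iff₀ (by linarith)]
  nlinarith

lemma div_one_sub_le_two_mul {a u : ℝ} (ha : 0 ≤ a) (hu : u ≤ 1 / 2) : a / (1 - u) ≤ 2 * a := by
  rw [div_le_iff₀ (by linarith)]
  nlinarith

namespace IsModelMethod

variable {E : Type*} [NormedAddCommGroup E] [InnerProductSpace ℝ E] [MeasurableSpace E]
  {Ω : Type*} [mΩ : MeasurableSpace Ω] {μ : Measure Ω} {ℱ : Filtration ℕ mΩ}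
  {f : E → ℝ} {φ : E → EReal} {F : ℕ → Ω → E → ℝ} {x g : ℕ → Ω → E} {α : ℕ → ℝ}
  {η τ ρ C D b bφ θ m : ℝ} {A L : ℝ≥0} {k : ℕ}

lemma ae_envelopeMerit_succ_le (hM : IsModelMethod μ ℱ f φ F x g α η τ C D b)
    (hφ : IsRegularizer φ ρ L bφ) (hψ : WeaklyConvex (η + ρ + τ) (compositeObj f φ)) (hθ : 0 < θ)
    {P : E → E} (hP : ∀ z, IsProx θ (compositeObj f φ) z (P z))
    (hx : ∀ᵐ ω ∂μ, x k ω ∈ effDom φ) (hαη : α k * η ≤ 1 / 2) (hαl : α k * (η + ρ) ≤ 1 / 2) :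
    ∀ᵐ ω ∂μ, envelopeMerit θ (compositeObj f φ) (b + bφ) (x (k + 1) ω)
      ≤ envelopeMerit θ (compositeObj f φ) (b + bφ) (x k ω)
        + α k / θ / (1 - α k * (η + ρ)) * (2 * α k * L ^ 2
          - (1 / θ - (η + ρ + τ)) * ‖x k ω - P (x k ω)‖ ^ 2)
        + α k / θ / (1 - α k * (η + ρ)) * ((F k ω (P (x k ω)) - f (P (x k ω))
          - τ / 2 * ‖x k ω - P (x k ω)‖ ^ 2) - (F k ω (x k ω) - f (x k ω))
          + 2 * α k * ‖g k ω‖ ^ 2) := by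
  filter_upwards [hM.weaklyConvex k, hM.mem_frechetSubdiff k, hM.isProx k, hx] with ω hH hg hp hxω
  have hα := hM.step_pos k
  have hden : 0 < 1 - α k * (η + ρ) := by linarith
  have hdescent := hφ.mul_moreauEnv_step_sub_le hH hg hp hxω hα hαη (by linarith) hψ hθ
    (hP _) (hP _)
  rw [← le_div_iff₀' hden, ← div_mul_eq_mul_div] at hdescent
  have hrate : 0 ≤ α k / θ / (1 - α k * (η + ρ)) := by positivity
  have hsplit := mul_le_mul_of_nonneg_left (add_sq_le (a := ‖g k ω‖) (b := (L : ℝ))) hα.le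
  unfold envelopeMerit
  linarith [mul_le_mul_of_nonneg_left hsplit hrate]

lemma integrable_self_sub (hM : IsModelMethod μ ℱ f φ F x g α η τ C D b) (k : ℕ) :
    Integrable (fun ω => F k ω (x k ω) - f (x k ω)) μ :=
  (hM.integrable_self k).sub (integrable_condExp.congr (hM.condExp_self k))

lemma condExp_self_sub [IsFiniteMeasure μ] (hM : IsModelMethod μ ℱ f φ F x g α η τ C D b)
    (k : ℕ) : μ[fun ω => F k ω (x k ω) - f (x k ω) | ℱ k] =ᵐ[μ] 0 := by
  have hf : μ[fun ω => f (x k ω) | ℱ k] =ᵐ[μ] μ[fun ω => F k ω (x k ω) | ℱ k] :=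
    (condExp_congr_ae (hM.condExp_self k).symm).trans (condExp_condExp_of_le le_rfl (ℱ.le k))
  refine (condExp_sub (hM.integrable_self k)
    (integrable_condExp.congr (hM.condExp_self k)) (ℱ k)).trans ?_
  filter_upwards [hf] with ω hω
  exact sub_eq_zero.2 hω.symm

lemma integrable_and_condExp_model_error_le [BorelSpace E] [SecondCountableTopology E]
    [IsFiniteMeasure μ] (hM : IsModelMethod μ ℱ f φ F x g α η τ C D b)
    (hφ : IsRegularizer φ ρ L bφ) (hf : HasQuadraticGapGrowth f (effDom φ) b A) {β : ℝ}
    (hβ : 0 ≤ β) {W : Ω → ℝ} (hW : μ[fun ω => ‖g k ω‖ ^ 2 | ℱ k] ≤ᵐ[μ] W)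
    {Y : Ω → E} (hY : Measurable[ℱ k] Y) (hYφ : ∀ ω, Y ω ∈ effDom φ) (hY2 : MemLp Y 2 μ) :
    Integrable (fun ω => F k ω (Y ω) - f (Y ω) - τ / 2 * ‖x k ω - Y ω‖ ^ 2
        - (F k ω (x k ω) - f (x k ω)) + β * ‖g k ω‖ ^ 2) μ ∧
      μ[fun ω => F k ω (Y ω) - f (Y ω) - τ / 2 * ‖x k ω - Y ω‖ ^ 2
        - (F k ω (x k ω) - f (x k ω)) + β * ‖g k ω‖ ^ 2 | ℱ k] ≤ᵐ[μ] fun ω => β * W ω := by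
  obtain ⟨hYi, hYle⟩ := hM.integrable_and_condExp_accuracy_nonpos hφ hf k hY hYφ hY2
  have hself := hM.integrable_self_sub k
  have hnoise := (hM.memLp_subgradient k).integrable_norm_pow two_ne_zero
  refine ⟨(hYi.sub hself).add (hnoise.const_mul β), ?_⟩
  filter_upwards [condExp_add (hYi.sub hself) (hnoise.const_mul β) (ℱ k),
    condExp_sub hYi hself (ℱ k), hYle, hM.condExp_self_sub k,
    condExp_const_mul_le hβ hW] with ω hadd hsub hYω hselfω hWω
  refine hadd.trans_le ?_
  rw [Pi.add_apply, hsub, Pi.sub_apply, hselfω]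
  exact (add_le_add (sub_nonpos.2 hYω) hWω).trans_eq (zero_add _)

variable [CompleteSpace E]

lemma condExp_norm_subgradient_sq_le_mul_envelopeMerit
    (hM : IsModelMethod μ ℱ f φ F x g α η τ C D b) (hφ : IsRegularizer φ ρ L bφ)
    (hf : HasQuadraticGapGrowth f (effDom φ) b A) (hψ : WeaklyConvex m (compositeObj f φ))
    (hθ : 0 < θ) (hm : θ * m < 1) (hx : ∀ᵐ ω ∂μ, x k ω ∈ effDom φ) :
    μ[fun ω => ‖g k ω‖ ^ 2 | ℱ k] ≤ᵐ[μ] fun ω => (|C| * (A * (1 + 2 * θ)) + |D|)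
      * envelopeMerit θ (compositeObj f φ) (b + bφ) (x k ω) := by
  filter_upwards [hM.condExp_norm_subgradient_sq_le k, hx] with ω hω hxω
  have hgap := sub_le_mul_envelopeMerit hφ hf hψ hθ hm hxω
  have hone := one_le_envelopeMerit hφ hf hψ hθ hm (x k ω)
  calc (μ[fun ω => ‖g k ω‖ ^ 2 | ℱ k]) ω ≤ C * (f (x k ω) - b) + D := hω
    _ ≤ |C| * (f (x k ω) - b) + |D| * 1 := by
        rw [mul_one]
        gcongr
        · exact sub_nonneg.2 (hf.le _ hxω)
        · exact le_abs_self C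
        · exact le_abs_self D
    _ ≤ |C| * (A * (1 + 2 * θ) * envelopeMerit θ (compositeObj f φ) (b + bφ) (x k ω))
        + |D| * envelopeMerit θ (compositeObj f φ) (b + bφ) (x k ω) := by gcongr
    _ = _ := by ring

lemma abs_norm_gradient_moreauEnv_succ_sub_le (hM : IsModelMethod μ ℱ f φ F x g α η τ C D b)
    (hφ : IsRegularizer φ ρ L bφ) (hf : HasQuadraticGapGrowth f (effDom φ) b A)
    (hψ : WeaklyConvex m (compositeObj f φ)) (hθ : 0 < θ) (hm : θ * m < 1)
    (hx : ∀ᵐ ω ∂μ, x k ω ∈ effDom φ) (hαη : α k * η ≤ 1 / 2) :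
    ∀ᵐ ω ∂μ, |‖gradient (moreauEnv θ (compositeObj f φ)) (x (k + 1) ω)‖
        - ‖gradient (moreauEnv θ (compositeObj f φ)) (x k ω)‖|
      ≤ 4 * (‖1 / θ‖ * (1 + (1 - θ * m)⁻¹)) * (1 + L) * α k * (‖g k ω‖ + 1) := by
  filter_upwards [hM.weaklyConvex k, hM.mem_frechetSubdiff k, hM.isProx k, hx] with ω hH hg hp hxω
  have hlip := (lipschitzWith_gradient_moreauEnv_compositeObj hφ hf hψ hθ hm).norm_sub_le
    (x (k + 1) ω) (x k ω)
  have hinv : 0 ≤ (1 - θ * m)⁻¹ := inv_nonneg.2 (sub_nonneg.2 hm.le)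
  rw [NNReal.coe_mul, coe_nnnorm, NNReal.coe_add, NNReal.coe_one,
    Real.coe_toNNReal _ hinv] at hlip
  have hα := hM.step_pos k
  calc |‖gradient (moreauEnv θ (compositeObj f φ)) (x (k + 1) ω)‖
        - ‖gradient (moreauEnv θ (compositeObj f φ)) (x k ω)‖|
      ≤ ‖1 / θ‖ * (1 + (1 - θ * m)⁻¹) * ‖x (k + 1) ω - x k ω‖ :=
        (abs_norm_sub_norm_le _ _).trans hlip
    _ ≤ ‖1 / θ‖ * (1 + (1 - θ * m)⁻¹) * (4 * α k * ((1 + L) * (‖g k ω‖ + 1))) := by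
        gcongr
        refine (hφ.norm_step_le hH hg hp hxω hα hαη).trans ?_
        gcongr
        linarith [mul_nonneg L.coe_nonneg (norm_nonneg (g k ω))]
    _ = _ := by ring

end IsModelMethod

end Descent

section Convergence

lemma merit_add_mul_le {a e r n c l θ δ : ℝ} (ha : 0 ≤ a) (he : 1 ≤ e) (hn : 0 ≤ n) (hc : 0 ≤ c)
    (hθ : 0 < θ) (hδ : 0 ≤ δ) (hlow : 2 / 3 * (a / θ) ≤ r) (hup : r ≤ 2 * (a / θ)) :
    e + r * (2 * a * l ^ 2 - δ * n) + r * (2 * a * (c * e))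
      ≤ (1 + 4 / θ * (c + l ^ 2) * a ^ 2) * e - 2 / 3 * (δ * θ) * a * (n / θ ^ 2) := by
  have herror : r * (2 * a * (l ^ 2 + c * e)) ≤ 2 * (a / θ) * (2 * a * ((c + l ^ 2) * e)) := by
    gcongr
    linarith [mul_le_mul_of_nonneg_left he (sq_nonneg l)]
  have hdecrease : 2 / 3 * (a / θ) * (δ * n) ≤ r * (δ * n) := by gcongr
  calc e + r * (2 * a * l ^ 2 - δ * n) + r * (2 * a * (c * e))
      = e + r * (2 * a * (l ^ 2 + c * e)) - r * (δ * n) := by ring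
    _ ≤ e + 2 * (a / θ) * (2 * a * ((c + l ^ 2) * e)) - 2 / 3 * (a / θ) * (δ * n) := by gcongr
    _ = (1 + 4 / θ * (c + l ^ 2) * a ^ 2) * e - 2 / 3 * (δ * θ) * a * (n / θ ^ 2) := by
      field_simp
      ring

/-- The filtration `k ↦ ℱ (k₀ + k)`, used to discard the first `k₀` steps of the method. -/
def shiftedFiltration {Ω : Type*} {mΩ : MeasurableSpace Ω} (ℱ : Filtration ℕ mΩ) (k₀ : ℕ) :
    Filtration ℕ mΩ where
  seq k := ℱ (k₀ + k)
  mono' _ _ hkl := ℱ.mono (Nat.add_le_add_left hkl k₀)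
  le' k := ℱ.le (k₀ + k)

namespace IsModelMethod

variable {E : Type*} [NormedAddCommGroup E] [InnerProductSpace ℝ E] [MeasurableSpace E]
  [BorelSpace E] [SecondCountableTopology E]
  {Ω : Type*} [mΩ : MeasurableSpace Ω] {μ : Measure Ω} [IsFiniteMeasure μ] {ℱ : Filtration ℕ mΩ}
  {f : E → ℝ} {φ : E → EReal} {F : ℕ → Ω → E → ℝ} {x g : ℕ → Ω → E} {α : ℕ → ℝ}
  {η τ ρ C D b bφ θ : ℝ} {A L : ℝ≥0}

lemma shift (hM : IsModelMethod μ ℱ f φ F x g α η τ C D b) (hφ : IsRegularizer φ ρ L bφ)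
    (k₀ : ℕ) : IsModelMethod μ (shiftedFiltration ℱ k₀) f φ (fun k => F (k₀ + k))
      (fun k => x (k₀ + k)) (fun k => g (k₀ + k)) (fun k => α (k₀ + k)) η τ C D b where
  measurable k := hM.measurable (k₀ + k)
  memLp_zero := hM.memLp_iterate hφ k₀
  isProx k := hM.isProx (k₀ + k)
  integrable_self k := hM.integrable_self (k₀ + k)
  condExp_self k := hM.condExp_self (k₀ + k)
  integrable k := hM.integrable (k₀ + k)
  condExp_sub_le k := hM.condExp_sub_le (k₀ + k)
  weaklyConvex k := hM.weaklyConvex (k₀ + k)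
  continuousOn k := hM.continuousOn (k₀ + k)
  mem_frechetSubdiff k := hM.mem_frechetSubdiff (k₀ + k)
  memLp_subgradient k := hM.memLp_subgradient (k₀ + k)
  condExp_norm_subgradient_sq_le k := hM.condExp_norm_subgradient_sq_le (k₀ + k)
  step_pos k := hM.step_pos (k₀ + k)
  step_mul_lt_one k := hM.step_mul_lt_one (k₀ + k)
  not_summable_step := by
    simpa only [add_comm k₀, summable_nat_add_iff] using hM.not_summable_step
  summable_step_sq := by
    simpa only [add_comm k₀, summable_nat_add_iff k₀ (f := fun k => α k ^ 2)]
      using hM.summable_step_sq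

section Rate

variable [CompleteSpace E] (hM : IsModelMethod μ ℱ f φ F x g α η τ C D b)
  (hφ : IsRegularizer φ ρ L bφ) (hf : HasQuadraticGapGrowth f (effDom φ) b A)
  (hψ : WeaklyConvex (η + ρ + τ) (compositeObj f φ)) (hθ : 0 < θ) (hm : θ * (η + ρ + τ) < 1)

include hM hφ hf hψ hθ hm

lemma condExp_envelopeMerit_le {c : ℝ} {k : ℕ} (hc : 0 ≤ c)
    (hx : ∀ᵐ ω ∂μ, x k ω ∈ effDom φ) (hαη : α k * η ≤ 1 / 2) (hαl : |α k * (η + ρ)| ≤ 1 / 2)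
    (hnoise : μ[fun ω => ‖g k ω‖ ^ 2 | ℱ k] ≤ᵐ[μ] fun ω =>
      c * envelopeMerit θ (compositeObj f φ) (b + bφ) (x k ω)) :
    μ[fun ω => envelopeMerit θ (compositeObj f φ) (b + bφ) (x (k + 1) ω) | ℱ k] ≤ᵐ[μ] fun ω =>
      (1 + 4 / θ * (c + L ^ 2) * α k ^ 2) * envelopeMerit θ (compositeObj f φ) (b + bφ) (x k ω)
        - 2 / 3 * ((1 / θ - (η + ρ + τ)) * θ) * α k
          * ‖gradient (moreauEnv θ (compositeObj f φ)) (x k ω)‖ ^ 2 := by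
  choose P hP using hφ.exists_isProx_compositeObj hf hψ hθ hm
  have hproper := properFunction_compositeObj (H := f) hφ.proper
  have hPlip := IsProx.lipschitzWith hP hproper hψ hθ hm
  have hPx2 : MemLp (P ∘ x k) 2 μ := memLp_comp_of_lipschitzWith hPlip (hM.memLp_iterate hφ k)
  have hα := hM.step_pos k
  set r := α k / θ / (1 - α k * (η + ρ))
  have hr0 : 0 ≤ r := le_trans (by positivity) (two_thirds_mul_le_div_one_sub (by positivity) hαl)
  have hmerit (j : ℕ) := integrable_envelopeMerit_comp hφ hf hψ hθ hm (hM.memLp_iterate hφ j)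
  let U : Ω → ℝ := fun ω => envelopeMerit θ (compositeObj f φ) (b + bφ) (x k ω)
    + r * (2 * α k * L ^ 2 - (1 / θ - (η + ρ + τ)) * ‖x k ω - P (x k ω)‖ ^ 2)
  have hU : Integrable U μ := (hmerit k).add (((integrable_const _).sub
    ((integrable_norm_sub_sq (hM.memLp_iterate hφ k) hPx2).const_mul _)).const_mul _)
  have hUm : StronglyMeasurable[ℱ k] U := by
    have hPcont := hPlip.continuous
    have hcont : Continuous fun z => envelopeMerit θ (compositeObj f φ) (b + bφ) z
        + r * (2 * α k * L ^ 2 - (1 / θ - (η + ρ + τ)) * ‖z - P z‖ ^ 2) :=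
      (continuous_envelopeMerit hφ hf hψ hθ hm).add (by fun_prop)
    exact hcont.comp_stronglyMeasurable (hM.measurable k).stronglyMeasurable
  obtain ⟨herri, herr⟩ := hM.integrable_and_condExp_model_error_le hφ hf
    (by positivity : 0 ≤ 2 * α k) hnoise (hPlip.continuous.measurable.comp (hM.measurable k))
    (fun ω => hφ.mem_effDom_of_isProx (hP _)) hPx2
  filter_upwards [condExp_le_add_of_ae_le_add (ℱ.le k) (hmerit (k + 1)) hU hUm
    (herri.const_mul r) (hM.ae_envelopeMerit_succ_le hφ hψ hθ hP hx hαη (le_of_abs_le hαl))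
    (condExp_const_mul_le hr0 herr)] with ω hω
  refine hω.trans ?_
  rw [IsProx.gradient_moreauEnv hP hproper hψ hθ hm, norm_smul, mul_pow, Real.norm_eq_abs, sq_abs,
    one_div_pow, one_div_mul_eq_div]
  exact merit_add_mul_le hα.le (one_le_envelopeMerit hφ hf hψ hθ hm _) (sq_nonneg _) hc hθ
    (sub_nonneg.2 ((le_div_iff₀' hθ).2 hm.le)) (two_thirds_mul_le_div_one_sub (by positivity) hαl)
    (div_one_sub_le_two_mul (by positivity) (le_of_abs_le hαl))

lemma stochasticDescent_of_le {c : ℝ} (hx : ∀ k, ∀ᵐ ω ∂μ, x k ω ∈ effDom φ)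
    (hαη : ∀ k, α k * η ≤ 1 / 2) (hαl : ∀ k, |α k * (η + ρ)| ≤ 1 / 2) (h₁ : 2 / θ ≤ c)
    (h₂ : |C| * (A * (1 + 2 * θ)) + |D| ≤ c)
    (h₃ : 4 * (‖1 / θ‖ * (1 + (1 - θ * (η + ρ + τ))⁻¹)) * (1 + L) ≤ c)
    (h₄ : 4 / θ * (|C| * (A * (1 + 2 * θ)) + |D| + L ^ 2) ≤ c) :
    StochasticDescent μ ℱ (fun k ω => envelopeMerit θ (compositeObj f φ) (b + bφ) (x k ω))
      (fun k ω => ‖gradient (moreauEnv θ (compositeObj f φ)) (x k ω)‖) (fun k ω => ‖g k ω‖)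
      α c (2 / 3 * ((1 / θ - (η + ρ + τ)) * θ)) := by
  have hmerit (k : ℕ) (ω : Ω) : 0 ≤ envelopeMerit θ (compositeObj f φ) (b + bφ) (x k ω) :=
    zero_le_one.trans (one_le_envelopeMerit hφ hf hψ hθ hm _)
  have hnoise (k : ℕ) :=
    hM.condExp_norm_subgradient_sq_le_mul_envelopeMerit hφ hf hψ hθ hm (hx k)
  have hgap : 0 < 1 / θ - (η + ρ + τ) := sub_pos.2 ((lt_div_iff₀' hθ).2 hm)
  have hcont := continuous_envelopeMerit hφ hf hψ hθ hm
  have hgrad := (lipschitzWith_gradient_moreauEnv_compositeObj hφ hf hψ hθ hm).continuous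
  exact {
    const_nonneg := le_trans (by positivity) h₁
    rate_pos := by positivity
    step_pos := hM.step_pos
    not_summable_step := hM.not_summable_step
    summable_step_sq := hM.summable_step_sq
    one_le_merit := fun k ω => one_le_envelopeMerit hφ hf hψ hθ hm _
    stronglyMeasurable_merit := fun k =>
      hcont.comp_stronglyMeasurable (hM.measurable k).stronglyMeasurable
    integrable_merit := fun k =>
      integrable_envelopeMerit_comp hφ hf hψ hθ hm (hM.memLp_iterate hφ k)
    stationarity_nonneg := fun k ω => norm_nonneg _
    stronglyMeasurable_stationarity := fun k =>
      hgrad.norm.comp_stronglyMeasurable (hM.measurable k).stronglyMeasurable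
    stationarity_sq_le := fun k ω =>
      (norm_gradient_moreauEnv_sq_le_mul_envelopeMerit hφ hf hψ hθ hm _).trans
        (mul_le_mul_of_nonneg_right h₁ (hmerit k ω))
    noise_nonneg := fun k ω => norm_nonneg _
    memLp_noise := fun k => (hM.memLp_subgradient k).norm
    condExp_noise_sq_le := fun k =>
      (hnoise k).mono fun ω hω => hω.trans (mul_le_mul_of_nonneg_right h₂ (hmerit k ω))
    abs_stationarity_sub_le := fun k => by
      have hα := hM.step_pos k
      exact (hM.abs_norm_gradient_moreauEnv_succ_sub_le hφ hf hψ hθ hm (hx k) (hαη k)).mono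
        fun ω hω => hω.trans (by gcongr)
    condExp_merit_le := fun k =>
      (hM.condExp_envelopeMerit_le hφ hf hψ hθ hm (by positivity) (hx k) (hαη k) (hαl k)
        (hnoise k)).mono fun ω hω => hω.trans (sub_le_sub_right (mul_le_mul_of_nonneg_right
          (by gcongr) (hmerit k ω)) _) }

lemma exists_stochasticDescent (hx : ∀ k, ∀ᵐ ω ∂μ, x k ω ∈ effDom φ)
    (hαη : ∀ k, α k * η ≤ 1 / 2) (hαl : ∀ k, |α k * (η + ρ)| ≤ 1 / 2) :
    ∃ c κ, StochasticDescent μ ℱ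
      (fun k ω => envelopeMerit θ (compositeObj f φ) (b + bφ) (x k ω))
      (fun k ω => ‖gradient (moreauEnv θ (compositeObj f φ)) (x k ω)‖) (fun k ω => ‖g k ω‖)
      α c κ :=
  ⟨2 / θ ⊔ (|C| * (A * (1 + 2 * θ)) + |D|)
      ⊔ (4 * (‖1 / θ‖ * (1 + (1 - θ * (η + ρ + τ))⁻¹)) * (1 + L)
        ⊔ 4 / θ * (|C| * (A * (1 + 2 * θ)) + |D| + L ^ 2)), _,
    hM.stochasticDescent_of_le hφ hf hψ hθ hm hx hαη hαl
      (le_sup_left.trans le_sup_left) (le_sup_right.trans le_sup_left)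
      (le_sup_left.trans le_sup_right) (le_sup_right.trans le_sup_right)⟩

lemma exists_stochasticDescent_shift :
    ∃ k₀ c κ, StochasticDescent μ (shiftedFiltration ℱ k₀)
      (fun k ω => envelopeMerit θ (compositeObj f φ) (b + bφ) (x (k₀ + k) ω))
      (fun k ω => ‖gradient (moreauEnv θ (compositeObj f φ)) (x (k₀ + k) ω)‖)
      (fun k ω => ‖g (k₀ + k) ω‖) (fun k => α (k₀ + k)) c κ := by
  obtain ⟨k₀, hk₀⟩ := eventually_atTop.1 ((hM.eventually_abs_step_mul_le_half η).and
    (hM.eventually_abs_step_mul_le_half (η + ρ)))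
  have hsmall (k : ℕ) := hk₀ (k₀ + 1 + k) (by lia)
  refine ⟨k₀ + 1, (hM.shift hφ (k₀ + 1)).exists_stochasticDescent hφ hf hψ hθ hm (fun k => ?_)
    (fun k => le_of_abs_le (hsmall k).1) fun k => (hsmall k).2⟩
  rw [Nat.add_right_comm]
  exact hM.ae_mem_effDom hφ (k₀ + k)

end Rate

end IsModelMethod

end Convergence

theorem mainTheorem6_general {E : Type*} [NormedAddCommGroup E] [InnerProductSpace ℝ E]
    [CompleteSpace E] [MeasurableSpace E] [BorelSpace E] [SecondCountableTopology E]
    {Ω : Type*} [mΩ : MeasurableSpace Ω] {μ : Measure Ω} [IsProbabilityMeasure μ]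
    {ℱ : Filtration ℕ mΩ} {f : E → ℝ} {φ : E → EReal} {F : ℕ → Ω → E → ℝ} {x g : ℕ → Ω → E}
    {α : ℕ → ℝ} {η τ ρ C D b bφ θ : ℝ} {A L : ℝ≥0}
    (hM : IsModelMethod μ ℱ f φ F x g α η τ C D b) (hφ : IsRegularizer φ ρ L bφ)
    (hf : HasQuadraticGapGrowth f (effDom φ) b A)
    (hψ : WeaklyConvex (η + ρ + τ) (compositeObj f φ)) (hθ : 0 < θ) (hm : θ * (η + ρ + τ) < 1) :
    Differentiable ℝ (moreauEnv θ (compositeObj f φ)) ∧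
      (∀ k, Integrable (fun ω => ‖gradient (moreauEnv θ (compositeObj f φ)) (x k ω)‖) μ) ∧
      Tendsto (fun k => ∫ ω, ‖gradient (moreauEnv θ (compositeObj f φ)) (x k ω)‖ ∂μ)
        atTop (𝓝 0) ∧
      ∀ᵐ ω ∂μ, Tendsto (fun k => ‖gradient (moreauEnv θ (compositeObj f φ)) (x k ω)‖)
        atTop (𝓝 0) := by
  obtain ⟨k₀, c, κ, hdescent⟩ := hM.exists_stochasticDescent_shift hφ hf hψ hθ hm
  refine ⟨differentiable_moreauEnv_compositeObj hφ hf hψ hθ hm, fun k => ?_, ?_, ?_⟩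
  · have hlip := lipschitzWith_gradient_moreauEnv_compositeObj hφ hf hψ hθ hm
    exact ((memLp_comp_of_lipschitzWith hlip (hM.memLp_iterate hφ k)).integrable
      one_le_two).norm
  · refine (tendsto_add_atTop_iff_nat k₀).1 ?_
    simpa only [add_comm k₀] using hdescent.tendsto_integral_stationarity
  · filter_upwards [hdescent.ae_tendsto_stationarity] with ω hω
    refine (tendsto_add_atTop_iff_nat k₀).1 ?_
    simpa only [add_comm k₀] using hω

lemma continuous_of_weaklyConvex_coe {E : Type*} [NormedAddCommGroup E] [InnerProductSpace ℝ E]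
    [FiniteDimensional ℝ E] {H : E → ℝ} {η : ℝ} (hH : WeaklyConvex η fun y => (H y : EReal)) :
    Continuous H := by
  rw [WeaklyConvex, effDom_coe] at hH
  have hquad : Continuous fun y : E => η / 2 * ‖y‖ ^ 2 := by fun_prop
  have hsum := continuousOn_univ.1 (hH.continuousOn isOpen_univ)
  exact (hsum.sub hquad).congr fun y => add_sub_cancel_right _ _

lemma sampleFiltration_zero {Ω Ξ : Type*} [MeasurableSpace Ω] [MeasurableSpace Ξ] (ξ : ℕ → Ω → Ξ)
    (hξ : ∀ k, Measurable (ξ k)) : sampleFiltration ξ hξ 0 = (⊥ : MeasurableSpace Ω) := by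
  simp [sampleFiltration]

theorem mainTheorem6 {n : ℕ} {Ω Ξ : Type*} [MeasurableSpace Ω] [MeasurableSpace Ξ]
    (μ : Measure Ω) [IsProbabilityMeasure μ]
    -- the objective `ψ = f + φ`, the models `fm x y ξ = f_x(y, ξ)`, the samples `ξ k`
    (f : EuclideanSpace ℝ (Fin n) → ℝ) (φ : EuclideanSpace ℝ (Fin n) → EReal)
    (fm : EuclideanSpace ℝ (Fin n) → EuclideanSpace ℝ (Fin n) → Ξ → ℝ)
    (ξ : ℕ → Ω → Ξ) (hξ : ∀ k, Measurable (ξ k))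
    -- the iterates, the subgradients of the models, the step sizes
    (x g : ℕ → Ω → EuclideanSpace ℝ (Fin n)) (α : ℕ → ℝ)
    (η ρ τ C D fbar φbar : ℝ) (Lφ Lf L : ℝ≥0)
    (hη : 0 ≤ η) (hρ : 0 ≤ ρ) (hτ : 0 ≤ τ) (hC : 0 ≤ C) (hD : 0 ≤ D)
    -- the iterates are adapted and generated by the model-based method
    (h_adapted : ∀ k, Measurable[sampleFiltration ξ hξ k] (x k))
    (h_update : ∀ k, ∀ᵐ ω ∂μ,
      IsMinOn (fun y => ((fm (x k ω) y (ξ k ω) : ℝ) : EReal) + φ y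
        + ((1 / (2 * α k) * ‖y - x k ω‖ ^ 2 : ℝ) : EReal)) Set.univ (x (k + 1) ω))
    -- one-sided accuracy of the models
    (h_int_self : ∀ k, Integrable (fun ω => fm (x k ω) (x k ω) (ξ k ω)) μ)
    (h_acc_self : ∀ k,
      μ[fun ω => fm (x k ω) (x k ω) (ξ k ω) | sampleFiltration ξ hξ k] =ᵐ[μ] fun ω => f (x k ω))
    (h_int : ∀ y ∈ effDom φ, ∀ k, Integrable (fun ω => fm (x k ω) y (ξ k ω)) μ)
    (h_acc : ∀ y ∈ effDom φ, ∀ k,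
      μ[fun ω => fm (x k ω) y (ξ k ω) - f y | sampleFiltration ξ hξ k]
        ≤ᵐ[μ] fun ω => τ / 2 * ‖x k ω - y‖ ^ 2)
    -- weak convexity of the models
    (h_model : ∀ k, ∀ᵐ ω ∂μ,
      WeaklyConvex η (fun y => ((fm (x k ω) y (ξ k ω) : ℝ) : EReal)))
    -- second moment bound for subgradients of the models
    (h_subgrad : ∀ k, ∀ᵐ ω ∂μ,
      g k ω ∈ frechetSubdiff (fun y => fm (x k ω) y (ξ k ω)) (x k ω))
    (h_g_int : ∀ k, MemLp (g k) 2 μ)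
    (h_g_bound : ∀ k,
      μ[fun ω => ‖g k ω‖ ^ 2 | sampleFiltration ξ hξ k]
        ≤ᵐ[μ] fun ω => C * (f (x k ω) - fbar) + D)
    -- the regularizer
    (hφ_bot : ∀ y, φ y ≠ ⊥) (hφ_proper : (effDom φ).Nonempty)
    (hφ_wc : WeaklyConvex ρ φ) (hφ_lsc : LowerSemicontinuous φ)
    (hφ_lip : LipschitzOnWith Lφ (fun y => (φ y).toReal) (effDom φ))
    (hφ_below : ∀ y ∈ effDom φ, (φbar : EReal) ≤ φ y)
    -- the step sizes
    (hα_pos : ∀ k, 0 < α k) (hα_small : ∀ k, α k * η < 1)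
    (hα_sum : Tendsto (fun N => ∑ k ∈ Finset.range N, α k) atTop atTop)
    (hα_sq : Summable fun k => α k ^ 2)
    -- regularity of `f` and weak convexity of the objective
    (hf : LipschitzScenario f φ fbar Lf ∨ SmoothScenario f fbar L)
    (hψ_wc : WeaklyConvex (η + ρ + τ) (compositeObj f φ)) :
    ∀ θ : ℝ, 0 < θ → θ * (η + ρ + τ) < 1 →
      Differentiable ℝ (moreauEnv θ (compositeObj f φ)) ∧
      (∀ k, Integrable (fun ω => ‖gradient (moreauEnv θ (compositeObj f φ)) (x k ω)‖) μ) ∧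
      Tendsto (fun k => ∫ ω, ‖gradient (moreauEnv θ (compositeObj f φ)) (x k ω)‖ ∂μ)
        atTop (𝓝 0) ∧
      ∀ᵐ ω ∂μ, Tendsto (fun k => ‖gradient (moreauEnv θ (compositeObj f φ)) (x k ω)‖)
        atTop (𝓝 0) := by
  intro θ hθ hm
  have hinit : MemLp (x 0) 2 μ := by
    obtain ⟨c, hc⟩ := eq_const_of_measurable_bot (sampleFiltration_zero ξ hξ ▸ h_adapted 0)
    exact hc ▸ memLp_const c
  have hcont (k : ℕ) : ∀ᵐ ω ∂μ, ContinuousOn (fun y => fm (x k ω) y (ξ k ω)) (effDom φ) :=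
    (h_model k).mono fun ω hω => (continuous_of_weaklyConvex_coe hω).continuousOn
  have hsum : ¬ Summable α :=
    (not_summable_iff_tendsto_nat_atTop_of_nonneg fun k => (hα_pos k).le).2 hα_sum
  have hM : IsModelMethod μ (sampleFiltration ξ hξ) f φ (fun k ω y => fm (x k ω) y (ξ k ω)) x g
      α η τ C D fbar :=
    ⟨h_adapted, hinit, h_update, h_int_self, h_acc_self, fun k y hy => h_int y hy k,
      fun k y hy => h_acc y hy k, h_model, hcont, h_subgrad, h_g_int, h_g_bound, hα_pos, hα_small,
      hsum, hα_sq⟩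
  have hφ : IsRegularizer φ ρ Lφ φbar :=
    ⟨⟨hφ_bot, hφ_proper⟩, hφ_wc, hφ_lsc, hφ_lip, hφ_below⟩
  obtain ⟨A, hA⟩ : ∃ A, HasQuadraticGapGrowth f (effDom φ) fbar A :=
    hf.elim (fun h => ⟨_, h.hasQuadraticGapGrowth⟩) fun h => ⟨_, h.hasQuadraticGapGrowth⟩
  exact mainTheorem6_general hM hφ hA hψ_wc hθ hm
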